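/- Let $k$ be a finite field of odd characteristic, let $P_1,\dots,P_s\in k[x]$ ($s\ge 1$) be distinct monic irreducible polynomials of degrees $d_1,\dots,d_s$, put $d=\sum_i d_i$ and write $d=2g+1$ or $d=2g+2$. Let $X_a$ be the smooth proper curve over $k$ with affine equation $y^2=P_1(x)\cdots P_s(x)$ (so $g$ is its genus), and let $r:X_a\to\mathbb{P}^1$, $(x,y)\mapsto(x:1)$, be the double covering. Number the roots $t_1,\dots,t_d\in\bar k$ of $P_1\cdots P_s$ so that $t_{d_1+\cdots+d_{i-1}+1},\dots,t_{d_1+\cdots+d_i}$ are the roots of $P_i$, cyclically permuted in this order by the Frobenius; write $t_j$ also for the point $(t_j,0)$ of $X_a\times_k\bar k$. Let $\lambda$ be a closed point of $\mathbb{A}^1_k\subset\mathbb{P}^1$ of odd degree $n$ with minimal polynomial $P_\lambda(x)$. Then: 1. If $d$ is odd, there is exactly one point $\infty$ of $X_a$ at infinity, and $r^*\lambda=\mathrm{div}(P_\lambda(x))+2n\,\infty$ as divisors on $X_a$. 2. If $d$ is even and $d_1$ is odd, then $t_1+\cdots+t_{d_1}$ is (the base change to $\bar k$ of) a divisor on $X_a$,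 and $$d_1\,r^*\lambda=\mathrm{div}\!\left(\frac{P_\lambda(x)^{d_1}}{P_1(x)^{n}}\right)+2n(t_1+\cdots+t_{d_1}).$$ 3. If $d_1,\dots,d_s$ and $g$ are all even (so $d=2g+2$), put $A=\prod_{i=1}^{g+1}(x-t_{2i-1})$ and $B=\prod_{i=1}^{g+1}(x-t_{2i})$. Then $A+B\in k[x]$, and the divisor $$D=\sum_{i=1}^{g+1}t_{2i-1}+\frac{n-g-1}{2}\,r^*\infty-\mathrm{div}\!\left(\frac{A}{A+y}\right)$$ on $X_a\times_k\bar k$ (where $\infty\in\mathbb{P}^1$ and $n-g-1$ is an even integer) is the base change of a divisor on $X_a$, also denoted $D$, which satisfies $$r^*\lambda=\mathrm{div}\!\left(\frac{P_\lambda(x)}{A+B+2y}\right)+2D.$$ 4. If $d_1,\dots,d_s$ are all even and $g$ is odd, then $r^*\lambda$ is not a square in $\mathrm{Pic}(X_a)$, i.e. its class is not of the form $2M$ with $M\in\mathrm{Pic}(X_a)$. -/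

import Mathlib

open Polynomial
open scoped WithZero

/-! ### Closed points, divisors and the Picard group of a smooth proper curve

The smooth proper curve with function field `K` over `F` is handled through its closed points:
these correspond to the discrete valuations of `K` that are trivial on `F`. -/

/-- A closed point of the smooth proper curve over `F` with function field `K`, given by its
normalised (surjective onto `ℤ` together with the value of `0`) discrete valuation on `K`, which is
trivial on `F`. The valuation is multiplicative: functions regular at the point have value `≤ 1`,
functions vanishing at the point have value `< 1`, uniformisers have value `exp (-1)`. -/
@[ext]
structure Place (F K : Type*) [Field F] [Field K] [Algebra F K] where
  val : Valuation K ℤᵐ⁰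
  trivialOn : ∀ a : F, a ≠ 0 → val (algebraMap F K a) = 1
  surjective : Function.Surjective val

/-- Order of vanishing of `h ≠ 0` at the point `v` (negative at a pole). -/
noncomputable def Place.ord {F K : Type*} [Field F] [Field K] [Algebra F K]
    (v : Place F K) (h : K) : ℤ :=
  -WithZero.log (v.val h)

/-- `div h = ∑ ord_v(h) v` as a function on closed points, for `h ≠ 0`. -/
noncomputable def divFun (F : Type*) {K : Type*} [Field F] [Field K] [Algebra F K] (h : K) :
    Place F K → ℤ :=
  fun v => v.ord h

/-- The group of divisors: finite formal sums of closed points. -/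
abbrev CurveDivisor (F K : Type*) [Field F] [Field K] [Algebra F K] := Place F K →₀ ℤ

/-- The subgroup of principal divisors. -/
def principalDivisors (F K : Type*) [Field F] [Field K] [Algebra F K] :
    AddSubgroup (CurveDivisor F K) where
  carrier := {D | ∃ h : K, h ≠ 0 ∧ ⇑D = divFun F h}
  zero_mem' := ⟨1, one_ne_zero, by funext v; simp [divFun, Place.ord]⟩
  add_mem' := by
    rintro D E ⟨h, hh, hD⟩ ⟨e, he, hE⟩
    refine ⟨h * e, mul_ne_zero hh he, ?_⟩
    funext v
    have h1 : v.val h ≠ 0 := v.val.ne_zero_iff.2 hh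
    have h2 : v.val e ≠ 0 := v.val.ne_zero_iff.2 he
    simp only [Finsupp.coe_add, Pi.add_apply, hD, hE, divFun, Place.ord, map_mul,
      WithZero.log_mul h1 h2]
    ring
  neg_mem' := by
    rintro D ⟨h, hh, hD⟩
    refine ⟨h⁻¹, inv_ne_zero hh, ?_⟩
    funext v
    simp only [Finsupp.coe_neg, Pi.neg_apply, hD, divFun, Place.ord, map_inv₀, WithZero.log_inv]

/-- The Picard group of the smooth proper curve: divisors modulo linear equivalence. -/
abbrev CurvePic (F K : Type*) [Field F] [Field K] [Algebra F K] :=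
  CurveDivisor F K ⧸ principalDivisors F K

open Classical in
/-- For a dominant morphism of curves given by `φ : K → L` on function fields, the ramification
index at the point `w` of the source over the point `v` of the target; it is `0` if `w` is not
mapped to `v`. -/
noncomputable def ramificationIndexAt {F K F' L : Type*} [Field F] [Field K] [Algebra F K]
    [Field F'] [Field L] [Algebra F' L] (φ : K →+* L) (w : Place F' L) (v : Place F K) : ℕ :=
  if h : ∃ e : ℕ, 0 < e ∧ ∀ a : K, w.val (φ a) = v.val a ^ e then Nat.find h else 0

/-- Pull-back of divisors along the dominant morphism given by `φ : K → L` on function fields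
(a finite morphism of curves, or a base change of the constant field `F → F'`): the coefficient at
`w` is `e(w/v) D(v)`, where `v` is the image of `w`. -/
noncomputable def pullbackDivisor {F K F' L : Type*} [Field F] [Field K] [Algebra F K]
    [Field F'] [Field L] [Algebra F' L] (φ : K →+* L) (D : CurveDivisor F K) :
    Place F' L → ℤ :=
  fun w => D.sum fun v m => (ramificationIndexAt φ w v : ℤ) * m

/-! ### The projective line -/

/-- The point `∞` of the projective line over `F`. -/
noncomputable def inftyPlace (F : Type*) [Field F] : Place F (RatFunc F) :=
  letI := Classical.decEq (RatFunc F)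
  { val := RatFunc.inftyValuation F
    trivialOn := fun a ha => Valuation.IsTrivialOn.eq_one (v := RatFunc.inftyValuation F) a ha
    surjective := by
      intro z
      by_cases hz : z = 0
      · exact ⟨0, by simp [hz]⟩
      · refine ⟨RatFunc.X ^ (WithZero.log z), ?_⟩
        rw [RatFunc.inftyValuation.X_zpow, WithZero.exp_log hz] }

/-- The closed point `lam` of the projective line lies on the affine line (with coordinate `X`) and
`Q` is its minimal polynomial, i.e. the monic polynomial generating the ideal of all polynomials
that vanish at `lam`. The degree of `lam` is then `Q.natDegree`. -/
def IsAffinePointWithMinpoly {F : Type*} [Field F] (lam : Place F (RatFunc F)) (Q : F[X]) : Prop :=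
  lam.val RatFunc.X ≤ 1 ∧ Q.Monic ∧
    ∀ R : F[X], lam.val (algebraMap F[X] (RatFunc F) R) < 1 ↔ Q ∣ R

/-! ### Hyperelliptic curves -/

/-- The data of an affine equation `y² = f(x)` with `f` separable and nonconstant, over a field of
characteristic different from `2`. -/
structure HyperellipticEquation (F : Type*) [Field F] where
  f : F[X]
  separable : f.Separable
  natDegree_pos : 0 < f.natDegree
  two_ne_zero : (2 : F) ≠ 0

namespace HyperellipticEquation

variable {F : Type*} [Field F] (E : HyperellipticEquation F)

/-- The polynomial `Y² - f(x)` over `F(x)`. -/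
noncomputable def poly : (RatFunc F)[X] := X ^ 2 - C (algebraMap F[X] (RatFunc F) E.f)

theorem irreducible_poly : Irreducible E.poly := by
  refine X_pow_sub_C_irreducible_of_prime Nat.prime_two fun b hb => ?_
  have hint : IsIntegral F[X] b := by
    refine ⟨X ^ 2 - C E.f, monic_X_pow_sub_C _ (by norm_num), ?_⟩
    simp [hb]
  obtain ⟨a, rfl⟩ := IsIntegrallyClosed.isIntegral_iff.1 hint
  have ha : a ^ 2 = E.f := by
    apply IsFractionRing.injective F[X] (RatFunc F)
    simpa using hb
  have hu : IsUnit a := E.separable.squarefree a ⟨1, by rw [← ha]; ring⟩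
  have h0 := natDegree_eq_zero_of_isUnit hu
  have h1 := E.natDegree_pos
  rw [← ha, natDegree_pow, h0] at h1
  simp at h1

instance : Fact (Irreducible E.poly) := ⟨E.irreducible_poly⟩

/-- The function field `F(x)[y] / (y² - f(x))` of the affine curve `y² = f(x)`, and hence of its
smooth proper model. The double covering `r : (x, y) ↦ (x : 1)` of the projective line is given
by the inclusion of `F(x)`. -/
abbrev FunctionField := AdjoinRoot E.poly

/-- The inclusion of `F(x)` into the function field, i.e. the double covering `r`. -/
noncomputable abbrev cover : RatFunc F →+* E.FunctionField := AdjoinRoot.of E.poly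

/-- The polynomial function `Q(x)`. -/
noncomputable def ofPoly (Q : F[X]) : E.FunctionField :=
  E.cover (algebraMap F[X] (RatFunc F) Q)

/-- The coordinate function `y`. -/
noncomputable def y : E.FunctionField := AdjoinRoot.root E.poly

theorem y_sq : E.y ^ 2 = E.ofPoly E.f := by
  have h : (X ^ 2 - C (algebraMap F[X] (RatFunc F) E.f)).eval₂ E.cover E.y = 0 :=
    AdjoinRoot.eval₂_root E.poly
  rw [eval₂_sub, eval₂_pow, eval₂_X, eval₂_C, sub_eq_zero] at h
  exact h

/-- The closed point `w` is the rational point `(a, b)`: `x - a` and `y - b` vanish there. -/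
def IsPoint (w : Place F E.FunctionField) (a b : F) : Prop :=
  w.val (E.ofPoly (X - C a)) < 1 ∧ w.val (E.y - E.ofPoly (C b)) < 1

/-- The closed point `w` lies over `∞`: `x` has a pole there. -/
def IsAtInfinity (w : Place F E.FunctionField) : Prop :=
  1 < w.val (E.ofPoly X)

variable (F' : Type*) [Field F'] [Algebra F F']

/-- The same equation over an extension field. -/
noncomputable def baseChange : HyperellipticEquation F' where
  f := E.f.map (algebraMap F F')
  separable := E.separable.map
  natDegree_pos := by rw [natDegree_map]; exact E.natDegree_pos
  two_ne_zero := by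
    have h := (map_ne_zero (algebraMap F F')).2 E.two_ne_zero
    rwa [map_ofNat] at h

/-- The inclusion `F(x) → F'(x)`. -/
noncomputable def _root_.ratFuncBaseChange (F : Type*) [Field F] (F' : Type*) [Field F']
    [Algebra F F'] : RatFunc F →+* RatFunc F' :=
  RatFunc.mapRingHom (Polynomial.mapRingHom (algebraMap F F')) (by
    intro p hp
    rw [Submonoid.mem_comap, mem_nonZeroDivisors_iff_ne_zero]
    rw [mem_nonZeroDivisors_iff_ne_zero] at hp
    simpa using hp)

theorem ratFuncBaseChange_algebraMap (Q : F[X]) :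
    ratFuncBaseChange F F' (algebraMap F[X] (RatFunc F) Q) =
      algebraMap F'[X] (RatFunc F') (Q.map (algebraMap F F')) := by
  have h := RatFunc.map_apply_div (Polynomial.mapRingHom (algebraMap F F'))
    (by
      intro p hp
      rw [Submonoid.mem_comap, mem_nonZeroDivisors_iff_ne_zero]
      rw [mem_nonZeroDivisors_iff_ne_zero] at hp
      simpa using hp) Q 1
  simpa [ratFuncBaseChange, RatFunc.coe_mapRingHom_eq_coe_map] using h

/-- The inclusion of the function field of the curve over `F` into that of its base change to `F'`:
it extends `F(x) → F'(x)` and sends `y` to `y`. -/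
noncomputable def toBaseChange : E.FunctionField →+* (E.baseChange F').FunctionField :=
  AdjoinRoot.lift (((E.baseChange F').cover).comp (ratFuncBaseChange F F')) (E.baseChange F').y (by
    have h : E.poly = X ^ 2 - C (algebraMap F[X] (RatFunc F) E.f) := rfl
    rw [h, eval₂_sub, eval₂_pow, eval₂_X, eval₂_C, RingHom.comp_apply,
      ratFuncBaseChange_algebraMap, (E.baseChange F').y_sq, sub_eq_zero]
    rfl)

end HyperellipticEquation

/-- The curve `y² = P₁(x) ⋯ P_s(x)` over a finite field of odd characteristic, for distinct monic
irreducible polynomials `P₁, …, P_s`, `s ≥ 1` (the index set is `{0, …, s - 1}`). -/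
noncomputable def hyperellipticOfFactors {k : Type*} [Field k] [Finite k] (hk : ringChar k ≠ 2)
    {s : ℕ} (hs : 0 < s) (P : Fin s → k[X]) (hmonic : ∀ i, (P i).Monic)
    (hirr : ∀ i, Irreducible (P i)) (hinj : Function.Injective P) : HyperellipticEquation k where
  f := ∏ i, P i
  separable := by
    refine separable_prod (fun i j hij => ?_) fun i => PerfectField.separable_of_irreducible (hirr i)
    refine ((hirr i).coprime_iff_not_dvd).2 fun hdvd => hij (hinj ?_)
    exact eq_of_monic_of_associated (hmonic i) (hmonic j)
      ((hirr i).associated_of_dvd (hirr j) hdvd)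
  natDegree_pos := by
    rw [natDegree_prod _ _ fun i _ => (hirr i).ne_zero]
    exact Finset.sum_pos (fun i _ => (hirr i).natDegree_pos) ⟨⟨0, hs⟩, Finset.mem_univ _⟩
  two_ne_zero := Ring.two_ne_zero hk

/-- `d₁ + ⋯ + d_{i-1}`, the number of roots of the factors preceding the `i`-th one. -/
noncomputable def rootOffset {k : Type*} [Field k] {s : ℕ} (P : Fin s → k[X]) (i : Fin s) : ℕ :=
  ∑ l ∈ Finset.Iio i, (P l).natDegree

/-- `t 0, t 1, …, t (d - 1)` is a numbering (starting at `0`) of the roots of `P₁, …, P_s` in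
`k'`: first those of `P₁`, then those of `P₂` and so on, and within each block of roots the
Frobenius `z ↦ z ^ #k` acts as the cyclic permutation `t_1 ↦ t_2 ↦ ⋯ ↦ t_{d_i} ↦ t_1` in the order
of the numbering. The values `t j` for `j ≥ d` are irrelevant. -/
def IsFrobeniusNumbering {k k' : Type*} [Field k] [Field k'] [Algebra k k'] {s : ℕ}
    (P : Fin s → k[X]) (t : ℕ → k') : Prop :=
  ∀ i : Fin s,
    (P i).map (algebraMap k k') =
        ∏ j ∈ Finset.range (P i).natDegree, (X - C (t (rootOffset P i + j))) ∧
      ∀ j < (P i).natDegree,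
        t (rootOffset P i + j) ^ Nat.card k = t (rootOffset P i + (j + 1) % (P i).natDegree)

/-!
The places of the curve `y² = f(x)` are studied through their restrictions to `F(x)`. Up to
squares, the discriminant of the quadratic extension is `f`, so a place `v` of `F(x)` has a single, doubly
ramified place above it if `f` has odd order at `v` (`Place.LiesOver.eq_two_of_odd`,
`Place.LiesOver.eq_of_odd`), and is unramified otherwise (`Place.LiesOver.eq_one_of_even`). Every
place extends, since integral closures of discrete valuation rings in finite separable extensions
are Dedekind (`Place.exists_liesOver_algebraMap`). As the order of `f` is not affected by a separable
extension of constants, the base change of the curve to `k̄` is unramified over the curve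
(`exists_liesOver_toBaseChange`), and divisors and orders of functions are preserved by pull-back.

Write `I` for the pull-back `r^*∞`, that is, the pole divisor of `x` (`poleOrder`). The pull-back of
a point with minimal polynomial `Q` is then `div Q + (deg Q) I`, and it is twice a point if `Q`
divides `f`. This gives the first two cases by comparing coefficients.

If all `P i` have even degree, the Frobenius exchanges the products `A` and `B` of the linear
factors of even and of odd index, so `Q = A + B` is rational over `k`, while `(A - B)² = c h²` with
`h` rational and `c ∈ k` not a square (`Polynomial.exists_of_conjugate_factorization`). The function
`u = Q + 2 y` satisfies `A u = (A + y)²` and has norm `Q² - 4 f = (A - B)²`; as `Q` and `f` are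
coprime, the divisor `div u + (g + 1) I` is even (`even_ord_ofPoly_add_two_mul_y`). If `g` is even
and `n` odd, the divisor `div u + n I` is therefore twice a divisor `D`, which has all the
properties required in the third case: these may be checked after multiplication by `2`.

For odd `g`, suppose that `r^*λ` is twice a class. Then there is a function `H` whose divisor is
congruent to `I` modulo `2`. Its norm is even at all finite places, hence a constant times a square
in `k(x)`, and multiplying `H` by `u` if necessary one may take the constant to be `1`, because `c`
is not a square and `div u` is even. By Hilbert's theorem 90, `H` is a square times a squarefree
polynomial `G` in `x`. At the finite places `G` has even order, so its irreducible factors are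
branch points and have even degree; but at infinity, where the covering is unramified, `deg G` has
to be odd (`not_forall_even_ord_sub_poleOrder`).
-/

/-! ### Orders of vanishing -/

namespace Place

section Ord

variable {F K : Type*} [Field F] [Field K] [Algebra F K] (v : Place F K)

theorem val_ne_zero {h : K} (hh : h ≠ 0) : v.val h ≠ 0 := v.val.ne_zero_iff.2 hh

theorem val_eq_exp {h : K} (hh : h ≠ 0) : v.val h = WithZero.exp (-v.ord h) := by
  rw [ord, neg_neg, WithZero.exp_log (v.val_ne_zero hh)]

theorem ord_eq_iff {h : K} (hh : h ≠ 0) {m : ℤ} : v.ord h = m ↔ v.val h = WithZero.exp (-m) := by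
  rw [v.val_eq_exp hh, WithZero.exp_inj, neg_inj]

@[simp] theorem ord_zero : v.ord 0 = 0 := by simp [ord]

@[simp] theorem ord_one : v.ord 1 = 0 := by simp [ord]

@[simp] theorem ord_neg (h : K) : v.ord (-h) = v.ord h := by simp [ord, Valuation.map_neg]

theorem ord_mul {a b : K} (ha : a ≠ 0) (hb : b ≠ 0) : v.ord (a * b) = v.ord a + v.ord b := by
  rw [ord, map_mul, WithZero.log_mul (v.val_ne_zero ha) (v.val_ne_zero hb), ord, ord]; ring

theorem ord_pow (a : K) (m : ℕ) : v.ord (a ^ m) = m * v.ord a := by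
  simp [ord, WithZero.log_pow]

theorem ord_inv (a : K) : v.ord a⁻¹ = -v.ord a := by simp [ord, WithZero.log_inv]

theorem ord_div {a b : K} (ha : a ≠ 0) (hb : b ≠ 0) : v.ord (a / b) = v.ord a - v.ord b := by
  rw [div_eq_mul_inv, v.ord_mul ha (inv_ne_zero hb), ord_inv, sub_eq_add_neg]

theorem ord_algebraMap (a : F) : v.ord (algebraMap F K a) = 0 := by
  by_cases ha : a = 0
  · simp [ha]
  · simp [ord, v.trivialOn a ha]

theorem val_lt_one_iff {h : K} (hh : h ≠ 0) : v.val h < 1 ↔ 0 < v.ord h := by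
  rw [v.val_eq_exp hh, ← WithZero.exp_zero, WithZero.exp_lt_exp]; omega

theorem val_le_one_iff {h : K} (hh : h ≠ 0) : v.val h ≤ 1 ↔ 0 ≤ v.ord h := by
  rw [v.val_eq_exp hh, ← WithZero.exp_zero, WithZero.exp_le_exp]; omega

theorem one_lt_val_iff {h : K} (hh : h ≠ 0) : 1 < v.val h ↔ v.ord h < 0 := by
  rw [v.val_eq_exp hh, ← WithZero.exp_zero, WithZero.exp_lt_exp]; omega

theorem le_ord_add {a b : K} (hab : a + b ≠ 0) {m : ℤ} (ha : a ≠ 0 → m ≤ v.ord a)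
    (hb : b ≠ 0 → m ≤ v.ord b) : m ≤ v.ord (a + b) := by
  have key : ∀ c : K, (c ≠ 0 → m ≤ v.ord c) → v.val c ≤ WithZero.exp (-m) := by
    intro c hc
    by_cases h0 : c = 0
    · simp [h0]
    · rw [v.val_eq_exp h0, WithZero.exp_le_exp]; have := hc h0; omega
  have h := v.val.map_add_le (key a ha) (key b hb)
  rw [v.val_eq_exp hab, WithZero.exp_le_exp] at h
  omega

theorem ord_add_eq_left {a b : K} (ha : a ≠ 0) (h : b ≠ 0 → v.ord a < v.ord b) :
    a + b ≠ 0 ∧ v.ord (a + b) = v.ord a := by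
  by_cases hb : b = 0
  · simp [hb, ha]
  have h1 : v.val b < v.val a := by
    rw [v.val_eq_exp ha, v.val_eq_exp hb, WithZero.exp_lt_exp]; have := h hb; omega
  have h2 := v.val.map_add_eq_of_lt_left h1
  exact ⟨fun h0 => by rw [h0, map_zero] at h2; exact v.val_ne_zero ha h2.symm,
    by rw [ord, h2, ord]⟩

theorem exists_ord_eq (m : ℤ) : ∃ h : K, h ≠ 0 ∧ v.ord h = m := by
  obtain ⟨h, hh⟩ := v.surjective (WithZero.exp (-m))
  refine ⟨h, fun h0 => ?_, by rw [ord, hh, WithZero.log_exp, neg_neg]⟩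
  rw [h0, map_zero] at hh
  exact WithZero.exp_ne_zero hh.symm

theorem eq_of_ord_eq {v w : Place F K} (h : ∀ a : K, a ≠ 0 → v.ord a = w.ord a) : v = w := by
  refine Place.ext (Valuation.ext fun a => ?_)
  by_cases ha : a = 0
  · simp [ha]
  · rw [v.val_eq_exp ha, w.val_eq_exp ha, h a ha]

/-- A place given by its order function on nonzero elements. -/
noncomputable def ofOrd (o : K → ℤ) (hone : o 1 = 0)
    (hmul : ∀ a b, a ≠ 0 → b ≠ 0 → o (a * b) = o a + o b)
    (hadd : ∀ a b, a ≠ 0 → b ≠ 0 → a + b ≠ 0 → min (o a) (o b) ≤ o (a + b))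
    (htriv : ∀ a : F, a ≠ 0 → o (algebraMap F K a) = 0) (hsurj : ∃ a, a ≠ 0 ∧ o a = 1) :
    Place F K :=
  letI := Classical.decEq K
  { val :=
      { toFun := fun a => if a = 0 then 0 else WithZero.exp (-o a)
        map_zero' := by simp
        map_one' := by simp [hone]
        map_mul' := by
          intro a b
          by_cases ha : a = 0
          · simp [ha]
          by_cases hb : b = 0
          · simp [hb]
          simp only [ha, hb, mul_eq_zero, or_self, if_false]
          rw [hmul a b ha hb, neg_add, WithZero.exp_add]
        map_add_le_max' := by
          intro a b
          by_cases ha : a = 0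
          · simp [ha]
          by_cases hb : b = 0
          · simp [hb]
          by_cases hab : a + b = 0
          · simp [hab]
          have := hadd a b ha hb hab
          simp only [ha, hb, hab, if_false, le_max_iff, WithZero.exp_le_exp]
          omega }
    trivialOn := fun a ha => by
      change (if algebraMap F K a = 0 then (0 : ℤᵐ⁰) else _) = 1
      rw [if_neg ((_root_.map_ne_zero _).2 ha), htriv a ha]; simp
    surjective := by
      have hpow : ∀ a : K, a ≠ 0 → ∀ m : ℕ, o (a ^ m) = m * o a := by
        intro a ha m
        induction m with
        | zero => simp [hone]
        | succ m ih => rw [pow_succ, hmul _ _ (pow_ne_zero _ ha) ha, ih]; push_cast; ring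
      have hinv : ∀ a : K, a ≠ 0 → o a⁻¹ = -o a := by
        intro a ha
        have := hmul a a⁻¹ ha (inv_ne_zero ha)
        rw [mul_inv_cancel₀ ha, hone] at this
        omega
      intro z
      by_cases hz : z = 0
      · exact ⟨0, by simp [hz]⟩
      obtain ⟨a, ha, h1⟩ := hsurj
      obtain ⟨m, hm | hm⟩ := Int.eq_nat_or_neg (WithZero.log z)
      · refine ⟨(a ^ m)⁻¹, ?_⟩
        change (if (a ^ m)⁻¹ = 0 then (0 : ℤᵐ⁰) else _) = z
        rw [if_neg (inv_ne_zero (pow_ne_zero _ ha)), hinv _ (pow_ne_zero _ ha), hpow a ha, h1,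
          mul_one, neg_neg, ← hm, WithZero.exp_log hz]
      · refine ⟨a ^ m, ?_⟩
        change (if a ^ m = 0 then (0 : ℤᵐ⁰) else _) = z
        rw [if_neg (pow_ne_zero _ ha), hpow a ha, h1, mul_one, ← hm, WithZero.exp_log hz] }

theorem ord_ofOrd (o : K → ℤ) (h1 h2 h3 h4 h5) {a : K} (ha : a ≠ 0) :
    (ofOrd (F := F) o h1 h2 h3 h4 h5).ord a = o a := by
  rw [ord_eq_iff _ ha]
  exact if_neg ha

end Ord

/-! ### Places lying over one another -/

section LiesOver

variable {F K F' L : Type*} [Field F] [Field K] [Algebra F K] [Field F'] [Field L] [Algebra F' L]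

/-- Under the morphism of curves given by `φ : K → L`, the place `w` is mapped to `v`, with
ramification index `e`. -/
def LiesOver (φ : K →+* L) (w : Place F' L) (v : Place F K) (e : ℕ) : Prop :=
  0 < e ∧ ∀ a : K, w.val (φ a) = v.val a ^ e

variable {φ : K →+* L} {w : Place F' L} {v v' : Place F K} {e e' : ℕ}

theorem LiesOver.ord (h : LiesOver φ w v e) (a : K) : w.ord (φ a) = e * v.ord a := by
  rw [Place.ord, h.2, WithZero.log_pow, Place.ord]; simp

theorem liesOver_of_ord (he : 0 < e) (h : ∀ a : K, a ≠ 0 → w.ord (φ a) = e * v.ord a) :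
    LiesOver φ w v e := by
  refine ⟨he, fun a => ?_⟩
  by_cases ha : a = 0
  · simp [ha, he.ne']
  · rw [w.val_eq_exp ((_root_.map_ne_zero φ).2 ha), h a ha, v.val_eq_exp ha, ← WithZero.exp_nsmul]
    simp

theorem LiesOver.unique (h : LiesOver φ w v e) (h' : LiesOver φ w v' e') : v = v' ∧ e = e' := by
  have hee : e = e' := by
    obtain ⟨a, -, ha⟩ := v.exists_ord_eq 1
    obtain ⟨b, -, hb⟩ := v'.exists_ord_eq 1
    have h1 := (h.ord a).symm.trans (h'.ord a)
    have h2 := (h.ord b).symm.trans (h'.ord b)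
    rw [ha, mul_one] at h1
    rw [hb, mul_one] at h2
    exact Nat.dvd_antisymm (Int.natCast_dvd_natCast.1 ⟨_, h2.symm⟩)
      (Int.natCast_dvd_natCast.1 ⟨_, h1⟩)
  refine ⟨eq_of_ord_eq fun a _ => ?_, hee⟩
  have h1 := (h.ord a).symm.trans (h'.ord a)
  rw [← hee] at h1
  exact mul_left_cancel₀ (by exact_mod_cast h.1.ne') h1

theorem LiesOver.ramificationIndexAt_eq (h : LiesOver φ w v e) :
    ramificationIndexAt φ w v = e := by
  classical
  have hex : ∃ e : ℕ, 0 < e ∧ ∀ a : K, w.val (φ a) = v.val a ^ e := ⟨e, h⟩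
  rw [ramificationIndexAt, dif_pos hex]
  exact (LiesOver.unique (φ := φ) (w := w) (v := v) (Nat.find_spec hex) h).2

/-- The coefficient of a pulled back divisor at a place is that at the image of the place times
the ramification index. -/
theorem LiesOver.pullbackDivisor_apply (h : LiesOver φ w v e) (D : CurveDivisor F K) :
    pullbackDivisor φ D w = e * D v := by
  classical
  rw [pullbackDivisor, Finsupp.sum, Finset.sum_eq_single v]
  · rw [h.ramificationIndexAt_eq]
  · intro v' _ hv'
    rw [ramificationIndexAt, dif_neg]
    · simp
    · rintro ⟨e', he'⟩
      exact hv' (LiesOver.unique (φ := φ) (w := w) (v := v') he' h).1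
  · intro hv
    rw [Finsupp.notMem_support_iff.1 hv, mul_zero]

theorem LiesOver.trans {F'' M : Type*} [Field F''] [Field M] [Algebra F'' M] {ψ : L →+* M}
    {u : Place F'' M} (h : LiesOver φ w v e) (h' : LiesOver ψ u w e') :
    LiesOver (ψ.comp φ) u v (e' * e) := by
  refine liesOver_of_ord (Nat.mul_pos h'.1 h.1) fun a _ => ?_
  rw [RingHom.comp_apply, h'.ord, h.ord]; push_cast; ring

theorem LiesOver.val_lt_one_iff (h : LiesOver φ w v e) (a : K) :
    w.val (φ a) < 1 ↔ v.val a < 1 := by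
  rw [h.2, pow_lt_one_iff h.1.ne']

theorem LiesOver.one_lt_val_iff (h : LiesOver φ w v e) (a : K) :
    1 < w.val (φ a) ↔ 1 < v.val a := by
  rw [h.2, one_lt_pow_iff h.1.ne']

theorem LiesOver.val_le_one_iff (h : LiesOver φ w v e) (a : K) :
    w.val (φ a) ≤ 1 ↔ v.val a ≤ 1 := by
  rw [h.2, pow_le_one_iff h.1.ne']

/-- A place of `L` that is trivial on the constants of `K` but not on `K` restricts to a place
of `K`. -/
theorem exists_liesOver (φ : K →+* L) (w : Place F' L)
    (hF : ∀ a : F, a ≠ 0 → w.ord (φ (algebraMap F K a)) = 0)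
    (hnt : ∃ a : K, w.ord (φ a) ≠ 0) : ∃ (v : Place F K) (e : ℕ), LiesOver φ w v e := by
  let H : AddSubgroup ℤ :=
    { carrier := {m | ∃ a : K, a ≠ 0 ∧ w.ord (φ a) = m}
      zero_mem' := ⟨1, one_ne_zero, by simp⟩
      add_mem' := by
        rintro m m' ⟨a, ha, rfl⟩ ⟨b, hb, rfl⟩
        exact ⟨a * b, mul_ne_zero ha hb, by
          rw [map_mul, w.ord_mul ((_root_.map_ne_zero φ).2 ha) ((_root_.map_ne_zero φ).2 hb)]⟩
      neg_mem' := by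
        rintro m ⟨a, ha, rfl⟩
        exact ⟨a⁻¹, inv_ne_zero ha, by rw [map_inv₀, ord_inv]⟩ }
  obtain ⟨c, hc⟩ := Int.subgroup_cyclic H
  have hmem : ∀ m : ℤ, (∃ a : K, a ≠ 0 ∧ w.ord (φ a) = m) ↔ c ∣ m := by
    intro m
    rw [← Int.mem_zmultiples_iff, AddSubgroup.zmultiples_eq_closure, ← hc]
    exact Iff.rfl
  have hc0 : c ≠ 0 := by
    rintro rfl
    obtain ⟨a, ha⟩ := hnt
    have ha0 : a ≠ 0 := by rintro rfl; simp at ha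
    exact ha (zero_dvd_iff.1 ((hmem _).1 ⟨a, ha0, rfl⟩))
  let e : ℕ := c.natAbs
  have he : 0 < e := Int.natAbs_pos.2 hc0
  have hmem' : ∀ m : ℤ, (∃ a : K, a ≠ 0 ∧ w.ord (φ a) = m) ↔ (e : ℤ) ∣ m := fun m => by
    rw [hmem, Int.natAbs_dvd]
  have hdiv : ∀ a : K, a ≠ 0 → (e : ℤ) * (w.ord (φ a) / e) = w.ord (φ a) := fun a ha =>
    Int.mul_ediv_cancel' ((hmem' _).1 ⟨a, ha, rfl⟩)
  have hepos : (0 : ℤ) < e := by exact_mod_cast he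
  refine ⟨ofOrd (fun a => w.ord (φ a) / e) (by simp) ?_ ?_ ?_ ?_, e, ?_⟩
  · intro a b ha hb
    rw [map_mul, w.ord_mul ((_root_.map_ne_zero φ).2 ha) ((_root_.map_ne_zero φ).2 hb),
      Int.add_ediv_of_dvd_left ((hmem' _).1 ⟨a, ha, rfl⟩)]
  · intro a b ha hb hab
    rw [min_le_iff]
    have h1 : min (w.ord (φ a)) (w.ord (φ b)) ≤ w.ord (φ (a + b)) := by
      have hab' : φ a + φ b ≠ 0 := by rw [← map_add]; exact (_root_.map_ne_zero φ).2 hab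
      rw [map_add]
      exact w.le_ord_add hab' (fun _ => min_le_left _ _) fun _ => min_le_right _ _
    rcases min_le_iff.1 h1 with h | h
    · exact Or.inl (Int.ediv_le_ediv hepos h)
    · exact Or.inr (Int.ediv_le_ediv hepos h)
  · intro a ha
    rw [hF a ha, Int.zero_ediv]
  · obtain ⟨a, ha, h⟩ := (hmem' (e : ℤ)).2 dvd_rfl
    exact ⟨a, ha, by rw [h, Int.ediv_self hepos.ne']⟩
  · refine liesOver_of_ord he fun a ha => ?_
    rw [ord_ofOrd _ _ _ _ _ _ ha, hdiv a ha]

/-- A place of `L` whose valuation ring contains that of `v`, and which is not trivial on `K`, lies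
over `v`. -/
theorem liesOver_of_val_le_one (h1 : ∀ a : K, v.val a ≤ 1 → w.val (φ a) ≤ 1)
    (hnt : ∃ a : K, w.ord (φ a) ≠ 0) : ∃ e : ℕ, LiesOver φ w v e := by
  have hunit : ∀ a : K, a ≠ 0 → v.ord a = 0 → w.ord (φ a) = 0 := by
    intro a ha h0
    have h2 := h1 a (by rw [v.val_le_one_iff ha, h0])
    have h3 := h1 a⁻¹ (by rw [v.val_le_one_iff (inv_ne_zero ha), ord_inv, h0, neg_zero])
    rw [w.val_le_one_iff ((_root_.map_ne_zero φ).2 ha)] at h2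
    rw [w.val_le_one_iff ((_root_.map_ne_zero φ).2 (inv_ne_zero ha)), map_inv₀, ord_inv] at h3
    omega
  obtain ⟨p, hp, hp1⟩ := v.exists_ord_eq 1
  have hp' : φ p ≠ 0 := (_root_.map_ne_zero φ).2 hp
  have hle : 0 ≤ w.ord (φ p) := by
    rw [← w.val_le_one_iff hp']
    exact h1 p (by rw [v.val_le_one_iff hp, hp1]; exact zero_le_one)
  have key : ∀ a : K, a ≠ 0 → w.ord (φ a) = w.ord (φ p) * v.ord a := by
    intro a ha
    have ha' : φ a ≠ 0 := (_root_.map_ne_zero φ).2 ha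
    obtain ⟨m, hm | hm⟩ := Int.eq_nat_or_neg (v.ord a)
    · have h0 := hunit (a / p ^ m) (div_ne_zero ha (pow_ne_zero _ hp)) (by
        rw [v.ord_div ha (pow_ne_zero _ hp), ord_pow, hp1, hm]; ring)
      rw [map_div₀, w.ord_div ha' ((_root_.map_ne_zero φ).2 (pow_ne_zero _ hp)), map_pow, ord_pow] at h0
      rw [hm]; linarith
    · have h0 := hunit (a * p ^ m) (mul_ne_zero ha (pow_ne_zero _ hp)) (by
        rw [v.ord_mul ha (pow_ne_zero _ hp), ord_pow, hp1, hm]; ring)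
      rw [map_mul, w.ord_mul ha' ((_root_.map_ne_zero φ).2 (pow_ne_zero _ hp)), map_pow, ord_pow] at h0
      rw [hm]; linarith
  obtain ⟨e, he⟩ := Int.eq_ofNat_of_zero_le hle
  refine ⟨e, liesOver_of_ord (Nat.pos_of_ne_zero ?_) fun a ha => by rw [key a ha, he]⟩
  rintro rfl
  obtain ⟨a, ha⟩ := hnt
  have ha0 : a ≠ 0 := by rintro rfl; simp at ha
  exact ha (by rw [key a ha0, he]; simp)

end LiesOver

/-! ### Extension of places -/

section Extension

variable {F K : Type*} [Field F] [Field K] [Algebra F K]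

theorem isDiscreteValuationRing_valuationSubring (v : Place F K) :
    IsDiscreteValuationRing v.val.valuationSubring := by
  have : IsCyclic (ℤᵐ⁰)ˣ :=
    have e : (ℤᵐ⁰)ˣ ≃* Multiplicative ℤ := WithZero.unitsWithZeroEquiv
    isCyclic_of_surjective e.symm e.symm.surjective
  have : v.val.IsNontrivial := by
    obtain ⟨x, hx⟩ := v.surjective (WithZero.exp 1)
    exact ⟨x, by rw [hx]; simp, by rw [hx]; simp⟩
  infer_instance

/-- Every place of `K` extends to a finite separable extension `L`: the integral closure in `L` of
the valuation ring is a Dedekind domain, and any of its nonzero primes will do. -/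
theorem exists_liesOver_algebraMap {L : Type*} [Field L] [Algebra F L] [Algebra K L]
    [IsScalarTower F K L] [FiniteDimensional K L] [Algebra.IsSeparable K L] (v : Place F K) :
    ∃ (w : Place F L) (e : ℕ), LiesOver (algebraMap K L) w v e := by
  let A := v.val.valuationSubring
  have hA : IsDiscreteValuationRing A := v.isDiscreteValuationRing_valuationSubring
  let B := integralClosure A L
  have : IsDedekindDomain B := integralClosure.isDedekindDomain A K L
  have : IsFractionRing B L := IsIntegralClosure.isFractionRing_of_finite_extension A K L B
  have hAB : Function.Injective (algebraMap A B) := by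
    have h : Function.Injective (algebraMap A L) := by
      rw [IsScalarTower.algebraMap_eq A K L]
      exact (algebraMap K L).injective.comp Subtype.val_injective
    rw [IsScalarTower.algebraMap_eq A B L, RingHom.coe_comp] at h
    exact Function.Injective.of_comp h
  obtain ⟨Q, hQmax, hQ⟩ := Ideal.exists_ideal_over_maximal_of_isIntegral (S := B)
    (IsLocalRing.maximalIdeal A) (by
      rw [(RingHom.injective_iff_ker_eq_bot _).1 hAB]; exact bot_le)
  obtain ⟨p, hp, hp1⟩ := v.exists_ord_eq 1
  have hpA : p ∈ A := (v.val_le_one_iff hp).2 (by rw [hp1]; exact zero_le_one)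
  have hpm : (⟨p, hpA⟩ : A) ∈ IsLocalRing.maximalIdeal A := by
    rw [IsLocalRing.mem_maximalIdeal, mem_nonunits_iff]
    intro hu
    have h1 := (Valuation.Integers.isUnit_iff_valuation_eq_one
      (Valuation.integer.integers v.val) (x := ⟨p, hpA⟩)).1 hu
    have h2 := (v.val_lt_one_iff hp).2 (by rw [hp1]; exact zero_lt_one)
    exact h2.ne h1
  have hpQ : algebraMap A B ⟨p, hpA⟩ ∈ Q := by
    rw [← Ideal.mem_comap, hQ]; exact hpm
  let q : IsDedekindDomain.HeightOneSpectrum B :=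
    ⟨Q, hQmax.isPrime, fun h0 => hp (by
      rw [h0, Ideal.mem_bot, map_eq_zero_iff _ hAB] at hpQ
      exact congrArg Subtype.val hpQ)⟩
  have hle : ∀ a : K, v.val a ≤ 1 → q.valuation L (algebraMap K L a) ≤ 1 := fun a ha =>
    q.valuation_le_one (K := L) (algebraMap A B ⟨a, ha⟩)
  let w : Place F L :=
    { val := q.valuation L
      trivialOn := fun a ha => by
        have h1 := hle (algebraMap F K a) (v.trivialOn a ha).le
        have h2 := hle (algebraMap F K a⁻¹) (v.trivialOn _ (inv_ne_zero ha)).le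
        rw [← IsScalarTower.algebraMap_apply] at h1 h2
        rw [map_inv₀, map_inv₀] at h2
        have h3 : q.valuation L (algebraMap F L a) ≠ 0 := by simpa using ha
        exact le_antisymm h1 ((inv_le_one₀ (zero_lt_iff.2 h3)).1 h2)
      surjective := q.valuation_surjective L }
  refine ⟨w, liesOver_of_val_le_one (w := w) hle ⟨p, ?_⟩⟩
  have h1 : w.val (algebraMap K L p) < 1 :=
    (q.valuation_lt_one_iff_mem (K := L) (algebraMap A B ⟨p, hpA⟩)).2 hpQ
  rw [w.val_lt_one_iff ((_root_.map_ne_zero _).2 hp)] at h1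
  exact h1.ne'

end Extension

end Place

/-! ### The places of the projective line -/

section ProjectiveLine

variable {F : Type*} [Field F] {v v' : Place F (RatFunc F)} {Q R : F[X]}

theorem algebraMap_ratFunc_ne_zero (hR : R ≠ 0) : algebraMap F[X] (RatFunc F) R ≠ 0 :=
  RatFunc.algebraMap_ne_zero hR

theorem Place.isTrivialOn (v : Place F (RatFunc F)) : v.val.IsTrivialOn F :=
  ⟨fun a ha => v.trivialOn a ha⟩

theorem Place.val_polynomial_le_one (hv : v.val RatFunc.X ≤ 1) (R : F[X]) :
    v.val (algebraMap F[X] (RatFunc F) R) ≤ 1 := by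
  have := v.isTrivialOn
  exact valuation_le_one_of_valuation_X_le_one _ hv R

theorem Place.ord_polynomial_nonneg (hv : v.val RatFunc.X ≤ 1) (R : F[X]) :
    0 ≤ v.ord (algebraMap F[X] (RatFunc F) R) := by
  by_cases hR : R = 0
  · simp [hR]
  · exact (v.val_le_one_iff (algebraMap_ratFunc_ne_zero hR)).1 (v.val_polynomial_le_one hv R)

theorem Place.exists_polynomial_ord_ne_zero (v : Place F (RatFunc F)) :
    ∃ R : F[X], R ≠ 0 ∧ v.ord (algebraMap F[X] (RatFunc F) R) ≠ 0 := by
  by_contra! h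
  obtain ⟨a, ha, h1⟩ := v.exists_ord_eq 1
  obtain ⟨p, q, hq, rfl⟩ := IsFractionRing.div_surjective (A := F[X]) a
  have hq0 : q ≠ 0 := nonZeroDivisors.ne_zero hq
  have hp0 : p ≠ 0 := by rintro rfl; simp at ha
  rw [v.ord_div (algebraMap_ratFunc_ne_zero hp0) (algebraMap_ratFunc_ne_zero hq0), h p hp0,
    h q hq0] at h1
  simp at h1

theorem IsAffinePointWithMinpoly.prime (h : IsAffinePointWithMinpoly v Q) : Prime Q := by
  refine ⟨h.2.1.ne_zero, fun hu => ?_, fun a b hab => ?_⟩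
  · have := (h.2.2 1).2 hu.dvd
    simp at this
  · rw [← h.2.2, map_mul, map_mul] at hab
    rw [← h.2.2, ← h.2.2]
    by_contra! hc
    exact absurd hab (not_lt.2 (one_le_mul hc.1 hc.2))

/-- A place of the affine line is a closed point with a minimal polynomial: the polynomials
vanishing there form a nonzero prime ideal. -/
theorem exists_isAffinePointWithMinpoly (hv : v.val RatFunc.X ≤ 1) :
    ∃ Q, IsAffinePointWithMinpoly v Q := by
  classical
  let I : Ideal F[X] :=
    { carrier := {R | v.val (algebraMap F[X] (RatFunc F) R) < 1}
      zero_mem' := by simp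
      add_mem' := fun {a b} ha hb => by
        change v.val (algebraMap F[X] (RatFunc F) (a + b)) < 1
        rw [map_add]; exact v.val.map_add_lt ha hb
      smul_mem' := fun c a ha => by
        change v.val (algebraMap F[X] (RatFunc F) (c * a)) < 1
        rw [map_mul, map_mul]
        exact (mul_le_of_le_one_left' (v.val_polynomial_le_one hv c)).trans_lt ha }
  obtain ⟨g, hg⟩ := (IsPrincipalIdealRing.principal I).principal
  have hmem : ∀ R, v.val (algebraMap F[X] (RatFunc F) R) < 1 ↔ g ∣ R := fun R => by
    rw [← Ideal.mem_span_singleton, Ideal.span, ← hg]; exact Iff.rfl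
  obtain ⟨R, hR, hR0⟩ := v.exists_polynomial_ord_ne_zero
  have hg0 : g ≠ 0 := by
    rintro rfl
    refine hR (zero_dvd_iff.1 ((hmem R).1 ?_))
    rw [v.val_lt_one_iff (algebraMap_ratFunc_ne_zero hR)]
    exact lt_of_le_of_ne (v.ord_polynomial_nonneg hv R) hR0.symm
  refine ⟨normalize g, hv, monic_normalize hg0, fun R => ?_⟩
  rw [hmem, normalize_dvd_iff]

theorem IsAffinePointWithMinpoly.ord_eq_zero (h : IsAffinePointWithMinpoly v Q) (hR : ¬ Q ∣ R) :
    v.ord (algebraMap F[X] (RatFunc F) R) = 0 := by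
  have hR0 : R ≠ 0 := by rintro rfl; exact hR (dvd_zero _)
  rw [← h.2.2, v.val_lt_one_iff (algebraMap_ratFunc_ne_zero hR0)] at hR
  exact le_antisymm (not_lt.1 hR) (v.ord_polynomial_nonneg h.1 R)

theorem IsAffinePointWithMinpoly.exists_ord_eq (h : IsAffinePointWithMinpoly v Q) (hR : R ≠ 0) :
    ∃ (m : ℕ) (R' : F[X]), ¬ Q ∣ R' ∧ R = Q ^ m * R' ∧
      v.ord (algebraMap F[X] (RatFunc F) R) = m * v.ord (algebraMap F[X] (RatFunc F) Q) := by
  obtain ⟨m, R', hR', rfl⟩ := WfDvdMonoid.max_power_factor hR h.prime.irreducible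
  refine ⟨m, R', hR', rfl, ?_⟩
  rw [map_mul, v.ord_mul (algebraMap_ratFunc_ne_zero (left_ne_zero_of_mul hR))
    (algebraMap_ratFunc_ne_zero (right_ne_zero_of_mul hR)), map_pow, Place.ord_pow,
    h.ord_eq_zero hR', add_zero]

theorem IsAffinePointWithMinpoly.ord_minpoly (h : IsAffinePointWithMinpoly v Q) :
    v.ord (algebraMap F[X] (RatFunc F) Q) = 1 := by
  have hQ := algebraMap_ratFunc_ne_zero h.2.1.ne_zero
  have hpos : 0 < v.ord (algebraMap F[X] (RatFunc F) Q) :=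
    (v.val_lt_one_iff hQ).1 ((h.2.2 Q).2 dvd_rfl)
  obtain ⟨a, ha, h1⟩ := v.exists_ord_eq 1
  obtain ⟨p, q, hq, rfl⟩ := IsFractionRing.div_surjective (A := F[X]) a
  have hq0 : q ≠ 0 := nonZeroDivisors.ne_zero hq
  have hp0 : p ≠ 0 := by rintro rfl; simp at ha
  obtain ⟨m, -, -, -, hm⟩ := h.exists_ord_eq hp0
  obtain ⟨m', -, -, -, hm'⟩ := h.exists_ord_eq hq0
  rw [v.ord_div (algebraMap_ratFunc_ne_zero hp0) (algebraMap_ratFunc_ne_zero hq0), hm, hm',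
    ← sub_mul] at h1
  exact (Int.eq_one_or_neg_one_of_mul_eq_one' h1).elim (fun h => h.2) fun h => by omega

theorem IsAffinePointWithMinpoly.ord_of_squarefree (h : IsAffinePointWithMinpoly v Q)
    (hR : Squarefree R) (hQ : Q ∣ R) : v.ord (algebraMap F[X] (RatFunc F) R) = 1 := by
  obtain ⟨S, rfl⟩ := hQ
  have h1 : ¬ Q ∣ S := fun ⟨S', hS⟩ => h.prime.not_isUnit (hR Q ⟨S', by rw [hS]; ring⟩)
  have h0 := hR.ne_zero
  rw [map_mul, v.ord_mul (algebraMap_ratFunc_ne_zero (left_ne_zero_of_mul h0))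
    (algebraMap_ratFunc_ne_zero (right_ne_zero_of_mul h0)), h.ord_minpoly, h.ord_eq_zero h1,
    add_zero]

theorem IsAffinePointWithMinpoly.eq (h : IsAffinePointWithMinpoly v Q)
    (h' : IsAffinePointWithMinpoly v' Q) : v = v' := by
  refine Place.eq_of_ord_eq fun a ha => ?_
  obtain ⟨p, q, hq, rfl⟩ := IsFractionRing.div_surjective (A := F[X]) a
  have hq0 : q ≠ 0 := nonZeroDivisors.ne_zero hq
  have hp0 : p ≠ 0 := by rintro rfl; simp at ha
  have key : ∀ R : F[X], R ≠ 0 → v.ord (algebraMap F[X] (RatFunc F) R) =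
      v'.ord (algebraMap F[X] (RatFunc F) R) := by
    intro R hR
    obtain ⟨m, R', hR', rfl⟩ := WfDvdMonoid.max_power_factor hR h.prime.irreducible
    have h1 := algebraMap_ratFunc_ne_zero (left_ne_zero_of_mul hR)
    have h2 := algebraMap_ratFunc_ne_zero (right_ne_zero_of_mul hR)
    rw [map_mul, v.ord_mul h1 h2, v'.ord_mul h1 h2, map_pow, Place.ord_pow, Place.ord_pow,
      h.ord_minpoly, h'.ord_minpoly, h.ord_eq_zero hR', h'.ord_eq_zero hR']
  have hp1 := algebraMap_ratFunc_ne_zero hp0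
  have hq1 := algebraMap_ratFunc_ne_zero hq0
  rw [v.ord_div hp1 hq1, v'.ord_div hp1 hq1, key p hp0, key q hq0]

theorem IsAffinePointWithMinpoly.eq_of_dvd (h : IsAffinePointWithMinpoly v Q) (hR : Irreducible R)
    (hRm : R.Monic) (hd : Q ∣ R) : Q = R :=
  eq_of_monic_of_associated h.2.1 hRm (h.prime.irreducible.associated_of_dvd hR hd)

theorem exists_place_of_irreducible (hQ : Irreducible Q) (hm : Q.Monic) :
    ∃ v : Place F (RatFunc F), IsAffinePointWithMinpoly v Q := by
  let q : IsDedekindDomain.HeightOneSpectrum F[X] :=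
    ⟨Ideal.span {Q}, (Ideal.span_singleton_prime hQ.ne_zero).2 hQ.prime,
      by simpa using hQ.ne_zero⟩
  refine ⟨⟨q.valuation (RatFunc F), fun a ha => ?_, q.valuation_surjective _⟩, ?_, hm, fun R => ?_⟩
  · rw [IsScalarTower.algebraMap_apply F F[X] (RatFunc F), q.valuation_eq_one_iff_notMem]
    intro hmem
    exact q.isPrime.ne_top (Ideal.eq_top_of_isUnit_mem _ hmem
      ((isUnit_iff_ne_zero.2 ha).map (algebraMap F F[X])))
  · rw [← RatFunc.algebraMap_X]; exact q.valuation_le_one _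
  · change q.valuation (RatFunc F) _ < 1 ↔ _
    rw [q.valuation_lt_one_iff_mem]
    exact Ideal.mem_span_singleton

theorem ord_inftyPlace (a : RatFunc F) : (inftyPlace F).ord a = -a.intDegree := by
  by_cases ha : a = 0
  · simp [ha]
  classical
  rw [Place.ord_eq_iff _ ha, neg_neg]
  exact RatFunc.inftyValuation_of_nonzero F ha

theorem ord_inftyPlace_polynomial (R : F[X]) :
    (inftyPlace F).ord (algebraMap F[X] (RatFunc F) R) = -R.natDegree := by
  rw [ord_inftyPlace, RatFunc.intDegree_polynomial]

theorem one_lt_inftyPlace_X : 1 < (inftyPlace F).val RatFunc.X := by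
  rw [Place.one_lt_val_iff _ RatFunc.X_ne_zero, ord_inftyPlace, RatFunc.intDegree_X]; simp

theorem eq_inftyPlace (hv : 1 < v.val RatFunc.X) : v = inftyPlace F := by
  have := v.isTrivialOn
  have key : ∀ a : RatFunc F, a ≠ 0 → v.ord a = a.intDegree * v.ord RatFunc.X := by
    intro a ha
    rw [Place.ord, RatFunc.valuation_eq_valuation_X_zpow_intDegree_of_one_lt_valuation_X hv ha,
      WithZero.log_zpow, Place.ord]
    simp
  obtain ⟨a, ha, h1⟩ := v.exists_ord_eq 1
  rw [v.one_lt_val_iff RatFunc.X_ne_zero] at hv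
  have hX : v.ord RatFunc.X = -1 := by
    rw [key a ha] at h1
    rcases Int.eq_one_or_neg_one_of_mul_eq_one' h1 with h | h <;> omega
  refine Place.eq_of_ord_eq fun a ha => ?_
  rw [key a ha, hX, ord_inftyPlace]; ring

theorem one_lt_val_X_iff : 1 < v.val RatFunc.X ↔ v = inftyPlace F :=
  ⟨eq_inftyPlace, fun h => h ▸ one_lt_inftyPlace_X⟩

/-- The order of the pole of the coordinate `X`, which is `1` at `∞` and `0` elsewhere. -/
theorem max_zero_neg_ord_X [Decidable (v = inftyPlace F)] :
    max 0 (-v.ord RatFunc.X) = if v = inftyPlace F then 1 else 0 := by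
  split_ifs with h
  · rw [h, ord_inftyPlace, RatFunc.intDegree_X]; simp
  · rw [← one_lt_val_X_iff, v.one_lt_val_iff RatFunc.X_ne_zero] at h
    omega

/-- The divisor of a monic irreducible polynomial of degree `n` on the projective line is its zero
minus `n` times the point `∞`. -/
theorem IsAffinePointWithMinpoly.ord_minpoly_apply {lam : Place F (RatFunc F)}
    (h : IsAffinePointWithMinpoly lam Q) [Decidable (v = lam)] :
    v.ord (algebraMap F[X] (RatFunc F) Q) =
      (if v = lam then 1 else 0) - Q.natDegree * max 0 (-v.ord RatFunc.X) := by
  classical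
  rw [max_zero_neg_ord_X]
  by_cases hv : v = inftyPlace F
  · have hne : v ≠ lam := by
      rintro rfl
      exact absurd h.1 (not_le.2 (hv ▸ one_lt_inftyPlace_X))
    rw [if_neg hne, if_pos hv, hv, ord_inftyPlace_polynomial]; ring
  · rw [if_neg hv, mul_zero, sub_zero]
    split_ifs with hvl
    · rw [hvl, h.ord_minpoly]
    · obtain ⟨Q', hQ'⟩ := exists_isAffinePointWithMinpoly
        (not_lt.1 fun h' => hv (one_lt_val_X_iff.1 h'))
      refine hQ'.ord_eq_zero fun hd => hvl ?_
      have := hQ'.eq_of_dvd h.prime.irreducible h.2.1 hd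
      exact (this ▸ hQ').eq h

theorem finite_setOf_polynomial_ord_ne_zero (R : F[X]) :
    {v : Place F (RatFunc F) | v.ord (algebraMap F[X] (RatFunc F) R) ≠ 0}.Finite := by
  classical
  by_cases hR : R = 0
  · simp [hR]
  have hfin : {Q : F[X] | Q.Monic ∧ Q ∣ R}.Finite :=
    Set.finite_coe_iff.1 (@Finite.of_fintype _ (fintypeSubtypeMonicDvd R hR))
  refine ((Set.finite_singleton (inftyPlace F)).union
    (hfin.biUnion (t := fun Q => {v | IsAffinePointWithMinpoly v Q}) fun Q _ =>
      Set.Subsingleton.finite fun v hv v' hv' => IsAffinePointWithMinpoly.eq hv hv')).subset ?_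
  intro v (hv : v.ord _ ≠ 0)
  by_cases hinf : v = inftyPlace F
  · exact Or.inl hinf
  obtain ⟨Q, hQ⟩ := exists_isAffinePointWithMinpoly
    (not_lt.1 fun h' => hinf (one_lt_val_X_iff.1 h'))
  refine Or.inr (Set.mem_biUnion (x := Q) ⟨hQ.2.1, ?_⟩ hQ)
  by_contra hd
  exact hv (hQ.ord_eq_zero hd)

theorem finite_setOf_ratFunc_ord_ne_zero (a : RatFunc F) :
    {v : Place F (RatFunc F) | v.ord a ≠ 0}.Finite := by
  obtain ⟨p, q, hq, rfl⟩ := IsFractionRing.div_surjective (A := F[X]) a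
  have hq0 : q ≠ 0 := nonZeroDivisors.ne_zero hq
  by_cases hp0 : p = 0
  · simp [hp0]
  refine ((finite_setOf_polynomial_ord_ne_zero p).union
    (finite_setOf_polynomial_ord_ne_zero q)).subset ?_
  intro v (hv : v.ord _ ≠ 0)
  by_contra h
  have h1 : v.ord (algebraMap F[X] (RatFunc F) p) = 0 := not_not.1 fun h' => h (Or.inl h')
  have h2 : v.ord (algebraMap F[X] (RatFunc F) q) = 0 := not_not.1 fun h' => h (Or.inr h')
  rw [v.ord_div (algebraMap_ratFunc_ne_zero hp0) (algebraMap_ratFunc_ne_zero hq0), h1, h2] at hv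
  exact hv (sub_zero 0)

end ProjectiveLine

/-! ### The function field of a hyperelliptic curve -/

namespace HyperellipticEquation

variable {F : Type*} [Field F] (E : HyperellipticEquation F)

theorem f_ne_zero : E.f ≠ 0 := E.separable.ne_zero

theorem f_ratFunc_ne_zero : algebraMap F[X] (RatFunc F) E.f ≠ 0 :=
  algebraMap_ratFunc_ne_zero E.f_ne_zero

theorem ofPoly_ne_zero {Q : F[X]} (hQ : Q ≠ 0) : E.ofPoly Q ≠ 0 :=
  (_root_.map_ne_zero E.cover).2 (algebraMap_ratFunc_ne_zero hQ)

theorem y_ne_zero : E.y ≠ 0 := by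
  intro h
  have := E.y_sq
  rw [h, zero_pow _root_.two_ne_zero] at this
  exact E.ofPoly_ne_zero E.f_ne_zero this.symm

theorem y_mul_y : E.y * E.y = E.cover (algebraMap F[X] (RatFunc F) E.f) := by
  rw [← sq, E.y_sq]; rfl

theorem cover_algebraMap (a : F) :
    E.cover (algebraMap F (RatFunc F) a) = algebraMap F E.FunctionField a := rfl

theorem cover_two_ne_zero : E.cover 2 ≠ 0 := by
  rw [show (2 : RatFunc F) = algebraMap F (RatFunc F) 2 from
    (map_ofNat (algebraMap F (RatFunc F)) 2).symm]
  exact (_root_.map_ne_zero _).2 ((_root_.map_ne_zero _).2 E.two_ne_zero)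

theorem exists_eq_add_mul_y (z : E.FunctionField) :
    ∃ a b : RatFunc F, z = E.cover a + E.cover b * E.y := by
  induction z using AdjoinRoot.induction_on with
  | ih p =>
    induction p using Polynomial.induction_on with
    | C a => exact ⟨a, 0, by rw [map_zero, zero_mul, add_zero]; rfl⟩
    | add p q hp hq =>
      obtain ⟨a, b, h⟩ := hp
      obtain ⟨a', b', h'⟩ := hq
      exact ⟨a + a', b + b', by rw [map_add, h, h', map_add, map_add]; ring⟩
    | monomial n a h =>
      obtain ⟨a', b', h'⟩ := h
      refine ⟨b' * algebraMap F[X] (RatFunc F) E.f, a', ?_⟩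
      rw [pow_succ, ← mul_assoc, map_mul, h', AdjoinRoot.mk_X, map_mul, ← E.y_mul_y]
      change _ * E.y = _
      ring

/-- The hyperelliptic involution `y ↦ -y` on functions. -/
noncomputable def conj : E.FunctionField →+* E.FunctionField :=
  AdjoinRoot.lift E.cover (-E.y) (by
    have h : (X ^ 2 - C (algebraMap F[X] (RatFunc F) E.f)).eval₂ E.cover (-E.y) = 0 := by
      rw [eval₂_sub, eval₂_pow, eval₂_X, eval₂_C, neg_sq, sq, E.y_mul_y, sub_self]
    exact h)

@[simp] theorem conj_cover (a : RatFunc F) : E.conj (E.cover a) = E.cover a :=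
  AdjoinRoot.lift_of _

@[simp] theorem conj_ofPoly (Q : F[X]) : E.conj (E.ofPoly Q) = E.ofPoly Q := E.conj_cover _

@[simp] theorem conj_y : E.conj E.y = -E.y := AdjoinRoot.lift_root _

@[simp] theorem conj_conj (z : E.FunctionField) : E.conj (E.conj z) = z := by
  obtain ⟨a, b, rfl⟩ := E.exists_eq_add_mul_y z
  simp

theorem mul_conj (a b : RatFunc F) :
    (E.cover a + E.cover b * E.y) * E.conj (E.cover a + E.cover b * E.y) =
      E.cover (a ^ 2 - b ^ 2 * algebraMap F[X] (RatFunc F) E.f) := by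
  rw [map_add, map_mul, conj_cover, conj_cover, conj_y, map_sub, map_mul, ← E.y_mul_y, map_pow,
    map_pow]
  ring

theorem exists_mul_conj_eq (z : E.FunctionField) : ∃ a : RatFunc F, z * E.conj z = E.cover a := by
  obtain ⟨a, b, rfl⟩ := E.exists_eq_add_mul_y z
  exact ⟨_, E.mul_conj a b⟩

theorem exists_add_conj_eq (z : E.FunctionField) : ∃ a : RatFunc F, z + E.conj z = E.cover a := by
  obtain ⟨a, b, rfl⟩ := E.exists_eq_add_mul_y z
  exact ⟨2 * a, by simp [map_ofNat]; ring⟩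

instance : FiniteDimensional (RatFunc F) E.FunctionField :=
  (monic_X_pow_sub_C (algebraMap F[X] (RatFunc F) E.f) _root_.two_ne_zero).finite_adjoinRoot

instance : Algebra.IsSeparable (RatFunc F) E.FunctionField := by
  have hy : IsSeparable (RatFunc F) E.y := by
    have h2 : ((2 : ℕ) : RatFunc F) ≠ 0 := fun h =>
      E.cover_two_ne_zero (by rw [show (2 : RatFunc F) = 0 by exact_mod_cast h, map_zero])
    refine (separable_X_pow_sub_C (n := 2) _ h2 E.f_ratFunc_ne_zero).of_dvd
      (minpoly.dvd _ _ ?_)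
    rw [map_sub, map_pow, aeval_X, aeval_C, sq, E.y_mul_y]
    exact sub_self _
  refine ⟨fun z => ?_⟩
  obtain ⟨a, b, rfl⟩ := E.exists_eq_add_mul_y z
  exact Field.isSeparable_add (isSeparable_algebraMap (F := RatFunc F) a)
    (Field.isSeparable_mul (isSeparable_algebraMap (F := RatFunc F) b) hy)

/-! ### Places of a hyperelliptic curve over places of the projective line -/

theorem exists_place_over (v : Place F (RatFunc F)) :
    ∃ (w : Place F E.FunctionField) (e : ℕ), Place.LiesOver E.cover w v e :=
  v.exists_liesOver_algebraMap (L := E.FunctionField)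

theorem two_mul_ord_y (w : Place F E.FunctionField) :
    2 * w.ord E.y = w.ord (E.ofPoly E.f) := by
  rw [← E.y_sq, Place.ord_pow]; rfl

theorem exists_place_under (w : Place F E.FunctionField) :
    ∃ (v : Place F (RatFunc F)) (e : ℕ), Place.LiesOver E.cover w v e := by
  refine Place.exists_liesOver E.cover w
    (fun a _ => by rw [cover_algebraMap]; exact w.ord_algebraMap a) ?_
  by_contra! h
  have hy : w.ord E.y = 0 := by
    have := E.two_mul_ord_y w
    rw [ofPoly, h] at this
    omega
  have key : ∀ z, z ≠ 0 → 0 ≤ w.ord z := by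
    intro z hz
    obtain ⟨a, b, rfl⟩ := E.exists_eq_add_mul_y z
    refine w.le_ord_add hz (fun _ => (h a).ge) fun hb => ?_
    rw [w.ord_mul (left_ne_zero_of_mul hb) E.y_ne_zero, h, hy, add_zero]
  obtain ⟨z, hz, h1⟩ := w.exists_ord_eq (-1)
  have := key z hz
  omega

section Over

variable {E} {v : Place F (RatFunc F)} {w w' : Place F E.FunctionField} {e e' : ℕ}

theorem _root_.Place.LiesOver.two_mul_ord_y (h : Place.LiesOver E.cover w v e) :
    2 * w.ord E.y = e * v.ord (algebraMap F[X] (RatFunc F) E.f) := by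
  rw [E.two_mul_ord_y, ofPoly, h.ord]

/-- If `f` has odd order at `v`, then `cover a` and `cover b * y` have orders of different parity
above `v`, up to scaling, so that the order of their sum is the minimum of the two. -/
theorem _root_.Place.LiesOver.ord_of_odd (h : Place.LiesOver E.cover w v e)
    (hodd : Odd (v.ord (algebraMap F[X] (RatFunc F) E.f))) {a b : RatFunc F} (ha : a ≠ 0)
    (hb : b ≠ 0) : w.ord (E.cover a + E.cover b * E.y) =
      min (w.ord (E.cover a)) (w.ord (E.cover b) + w.ord E.y) := by
  have ha' : E.cover a ≠ 0 := (_root_.map_ne_zero _).2 ha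
  have hb' : E.cover b ≠ 0 := (_root_.map_ne_zero _).2 hb
  have hmul := w.ord_mul hb' E.y_ne_zero
  have hne : w.ord (E.cover a) ≠ w.ord (E.cover b) + w.ord E.y := by
    intro heq
    have h2 := h.two_mul_ord_y
    rw [h.ord, h.ord] at heq
    have he : (e : ℤ) ≠ 0 := by exact_mod_cast h.1.ne'
    obtain ⟨m, hm⟩ := hodd
    have h3 : (e : ℤ) * (2 * v.ord a) = e * (2 * v.ord b + (2 * m + 1)) := by
      rw [← hm]; linarith
    have := mul_left_cancel₀ he h3
    omega
  rcases lt_or_gt_of_ne hne with hlt | hlt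
  · rw [min_eq_left hlt.le]
    exact (w.ord_add_eq_left ha' fun _ => by rwa [hmul]).2
  · rw [min_eq_right hlt.le, add_comm, ← hmul]
    exact (w.ord_add_eq_left (mul_ne_zero hb' E.y_ne_zero) fun _ => by rwa [hmul]).2

theorem _root_.Place.LiesOver.eq_two_of_odd (h : Place.LiesOver E.cover w v e)
    (hodd : Odd (v.ord (algebraMap F[X] (RatFunc F) E.f))) : e = 2 := by
  have h2 := h.two_mul_ord_y
  have he : Even (e : ℤ) := by
    have : Even ((e : ℤ) * v.ord (algebraMap F[X] (RatFunc F) E.f)) := ⟨_, by rw [← h2]; ring⟩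
    exact (Int.even_mul.1 this).resolve_right (Int.not_even_iff_odd.2 hodd)
  obtain ⟨m, hm⟩ := he
  have hy : m ∣ w.ord E.y := ⟨v.ord (algebraMap F[X] (RatFunc F) E.f), by
    rw [hm] at h2; linarith⟩
  have hc : ∀ a : RatFunc F, m ∣ w.ord (E.cover a) := fun a => by
    rw [h.ord, hm]; exact ⟨2 * v.ord a, by ring⟩
  obtain ⟨z, hz, h1⟩ := w.exists_ord_eq 1
  have hm1 : m ∣ 1 := by
    rw [← h1]
    obtain ⟨a, b, rfl⟩ := E.exists_eq_add_mul_y z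
    by_cases ha : a = 0
    · subst ha
      rw [map_zero, zero_add] at hz ⊢
      rw [w.ord_mul (left_ne_zero_of_mul hz) E.y_ne_zero]
      exact dvd_add (hc b) hy
    by_cases hb : b = 0
    · simpa [hb] using hc a
    rw [h.ord_of_odd hodd ha hb]
    rcases min_choice (w.ord (E.cover a)) (w.ord (E.cover b) + w.ord E.y) with h | h <;> rw [h]
    · exact hc a
    · exact dvd_add (hc b) hy
  have hpos := h.1
  have := Int.le_of_dvd one_pos hm1
  omega

/-- There is at most one place over a place where `f` has odd order. -/
theorem _root_.Place.LiesOver.eq_of_odd (h : Place.LiesOver E.cover w v e)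
    (h' : Place.LiesOver E.cover w' v e')
    (hodd : Odd (v.ord (algebraMap F[X] (RatFunc F) E.f))) : w = w' := by
  have he := h.eq_two_of_odd hodd
  have he' := h'.eq_two_of_odd hodd
  have hy : w.ord E.y = w'.ord E.y := by
    have h1 := h.two_mul_ord_y
    have h2 := h'.two_mul_ord_y
    rw [he] at h1
    rw [he'] at h2
    omega
  have hc : ∀ a, w.ord (E.cover a) = w'.ord (E.cover a) := fun a => by
    rw [h.ord, h'.ord, he, he']
  refine Place.eq_of_ord_eq fun z hz => ?_
  obtain ⟨a, b, rfl⟩ := E.exists_eq_add_mul_y z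
  by_cases ha : a = 0
  · subst ha
    rw [map_zero, zero_add] at hz ⊢
    rw [w.ord_mul (left_ne_zero_of_mul hz) E.y_ne_zero,
      w'.ord_mul (left_ne_zero_of_mul hz) E.y_ne_zero, hc, hy]
  by_cases hb : b = 0
  · simpa [hb] using hc a
  rw [h.ord_of_odd hodd ha hb, h'.ord_of_odd hodd ha hb, hc, hc, hy]

/-- A function over a place `v` where `f` has the same order as `c ^ 2` is a rational function of
`x` times either a unit above `v`, or `a + y / c` with `a` regular at `v`. -/
theorem exists_normal_form {c : RatFunc F} (hc : c ≠ 0)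
    (hcv : 2 * v.ord c = v.ord (algebraMap F[X] (RatFunc F) E.f)) {z : E.FunctionField}
    (hz : z ≠ 0) : ∃ (r : RatFunc F) (u : E.FunctionField), r ≠ 0 ∧ u ≠ 0 ∧ z = E.cover r * u ∧
      ((∀ (w : Place F E.FunctionField) (e : ℕ), Place.LiesOver E.cover w v e → w.ord u = 0) ∨
        ∃ a, v.val a ≤ 1 ∧ u = E.cover a + E.y / E.cover c) := by
  have hc' : E.cover c ≠ 0 := (_root_.map_ne_zero _).2 hc
  have hη : E.y / E.cover c ≠ 0 := div_ne_zero E.y_ne_zero hc'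
  have hordη : ∀ (w : Place F E.FunctionField) (e : ℕ), Place.LiesOver E.cover w v e → w.ord (E.y / E.cover c) = 0 := by
    intro w e h
    have := h.two_mul_ord_y
    rw [← hcv] at this
    rw [w.ord_div E.y_ne_zero hc', h.ord]
    linarith
  obtain ⟨a, b, hab⟩ := E.exists_eq_add_mul_y z
  have hb' : E.cover b * E.y = E.cover (b * c) * (E.y / E.cover c) := by
    rw [map_mul]; field_simp
  rw [hb'] at hab
  generalize b * c = b₁ at hab
  by_cases hb : b₁ = 0
  · subst hb
    rw [map_zero, zero_mul, add_zero] at hab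
    exact ⟨a, 1, fun h => hz (by rw [hab, h, map_zero]), one_ne_zero, by rw [hab, mul_one],
      Or.inl fun w e _ => w.ord_one⟩
  have hbc : E.cover b₁ ≠ 0 := (_root_.map_ne_zero _).2 hb
  by_cases hlt : a ≠ 0 ∧ v.ord a < v.ord b₁
  · have ha' : E.cover a ≠ 0 := (_root_.map_ne_zero _).2 hlt.1
    have hu : z = E.cover a * (1 + E.cover b₁ / E.cover a * (E.y / E.cover c)) := by
      rw [hab]; field_simp
    refine ⟨a, _, hlt.1, fun h => hz (by rw [hu, h, mul_zero]), hu, Or.inl fun w e h => ?_⟩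
    rw [(w.ord_add_eq_left one_ne_zero fun _ => ?_).2, w.ord_one]
    rw [w.ord_one, w.ord_mul (div_ne_zero hbc ha') hη, w.ord_div hbc ha', hordη w e h, h.ord,
      h.ord]
    have he : (0 : ℤ) < e := by exact_mod_cast h.1
    nlinarith [hlt.2]
  · have hu : z = E.cover b₁ * (E.cover (a / b₁) + E.y / E.cover c) := by
      rw [hab, map_div₀]; field_simp
    refine ⟨b₁, _, hb, fun h => hz (by rw [hu, h, mul_zero]), hu, Or.inr ⟨_, ?_, rfl⟩⟩
    by_cases ha : a = 0
    · simp [ha]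
    rw [v.val_le_one_iff (div_ne_zero ha hb), v.ord_div ha hb]
    have : ¬ v.ord a < v.ord b₁ := fun h => hlt ⟨ha, h⟩
    omega

/-- If `f` has the same order as `c ^ 2` at `v`, then `a + y / c` with `a` regular at `v` is either
a unit at a place above `v`, or has the same order there as its norm. -/
theorem _root_.Place.LiesOver.ord_normal_form (h : Place.LiesOver E.cover w v e) {c : RatFunc F}
    (hc : c ≠ 0) (hcv : 2 * v.ord c = v.ord (algebraMap F[X] (RatFunc F) E.f)) {a : RatFunc F}
    (ha : v.val a ≤ 1) (hu : E.cover a + E.y / E.cover c ≠ 0) :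
    w.ord (E.cover a + E.y / E.cover c) = 0 ∨
      w.val (E.cover a + E.y / E.cover c) < 1 ∧ w.ord (E.cover a + E.y / E.cover c) =
        e * v.ord (a ^ 2 - algebraMap F[X] (RatFunc F) E.f / c ^ 2) := by
  have hc' : E.cover c ≠ 0 := (_root_.map_ne_zero _).2 hc
  have hη : E.y / E.cover c ≠ 0 := div_ne_zero E.y_ne_zero hc'
  have hordη : w.ord (E.y / E.cover c) = 0 := by
    have := h.two_mul_ord_y
    rw [← hcv] at this
    rw [w.ord_div E.y_ne_zero hc', h.ord]
    linarith
  set u := E.cover a + E.y / E.cover c with hudef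
  have hle : 0 ≤ w.ord u := by
    refine w.le_ord_add hu (fun h0 => ?_) fun _ => hordη.ge
    rw [← w.val_le_one_iff h0, h.val_le_one_iff]; exact ha
  rcases hle.eq_or_lt with h0 | hpos
  · exact Or.inl h0.symm
  refine Or.inr ⟨(w.val_lt_one_iff hu).2 hpos, ?_⟩
  have hconj : E.conj u = -(E.cover 2 * (E.y / E.cover c)) + u := by
    rw [hudef, map_add, map_div₀, conj_cover, conj_cover, conj_y, map_ofNat]; ring
  have h2 : w.ord (E.cover 2) = 0 := by
    rw [show (2 : RatFunc F) = algebraMap F (RatFunc F) 2 from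
    (map_ofNat (algebraMap F (RatFunc F)) 2).symm, cover_algebraMap,
      w.ord_algebraMap]
  have h2η : w.ord (-(E.cover 2 * (E.y / E.cover c))) = 0 := by
    rw [Place.ord_neg, w.ord_mul E.cover_two_ne_zero hη, h2, hordη, add_zero]
  obtain ⟨hne, hord⟩ := w.ord_add_eq_left (a := -(E.cover 2 * (E.y / E.cover c))) (b := u)
    (neg_ne_zero.2 (mul_ne_zero E.cover_two_ne_zero hη)) fun _ => by rwa [h2η]
  rw [← hconj, h2η] at hord
  rw [← hconj] at hne
  have hN : u * E.conj u = E.cover (a ^ 2 - algebraMap F[X] (RatFunc F) E.f / c ^ 2) := by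
    have := E.mul_conj a c⁻¹
    rw [map_inv₀, inv_mul_eq_div, inv_pow, inv_mul_eq_div] at this
    exact this
  rw [← h.ord, ← hN, w.ord_mul hu hne, hord, add_zero]

/-- A place of the projective line where `f` has even order is unramified in the curve. -/
theorem _root_.Place.LiesOver.eq_one_of_even (h : Place.LiesOver E.cover w v e)
    (heven : Even (v.ord (algebraMap F[X] (RatFunc F) E.f))) : e = 1 := by
  obtain ⟨m, hm⟩ := heven
  obtain ⟨c, hc, hcm⟩ := v.exists_ord_eq m
  have hcv : 2 * v.ord c = v.ord (algebraMap F[X] (RatFunc F) E.f) := by rw [hcm, hm]; ring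
  obtain ⟨z, hz, h1⟩ := w.exists_ord_eq 1
  have hdvd : (e : ℤ) ∣ w.ord z := by
    obtain ⟨r, u, hr, hu, rfl, hcase⟩ := exists_normal_form hc hcv hz
    rw [w.ord_mul ((_root_.map_ne_zero _).2 hr) hu, h.ord]
    refine dvd_add (dvd_mul_right _ _) ?_
    rcases hcase with h0 | ⟨a, ha, rfl⟩
    · rw [h0 w e h]; exact dvd_zero _
    · rcases h.ord_normal_form hc hcv ha hu with h0 | ⟨-, h0⟩ <;> rw [h0]
      · exact dvd_zero _
      · exact dvd_mul_right _ _
  rw [h1] at hdvd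
  exact Nat.dvd_one.1 (by exact_mod_cast hdvd)

variable (w) in
/-- The image of a place under the hyperelliptic involution. -/
noncomputable def conjPlace : Place F E.FunctionField where
  val := w.val.comap E.conj
  trivialOn a ha := by
    rw [Valuation.comap_apply, ← cover_algebraMap, conj_cover, cover_algebraMap, w.trivialOn a ha]
  surjective x := by
    obtain ⟨z, hz⟩ := w.surjective x
    exact ⟨E.conj z, by rw [Valuation.comap_apply, conj_conj, hz]⟩

theorem ord_conjPlace (z : E.FunctionField) : (conjPlace w).ord z = w.ord (E.conj z) := rfl

theorem _root_.Place.LiesOver.conjPlace (h : Place.LiesOver E.cover w v e) :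
    Place.LiesOver E.cover (conjPlace w) v e :=
  ⟨h.1, fun a => by
    change w.val (E.conj (E.cover a)) = _
    rw [conj_cover, h.2]⟩

/-- Two places over `v` at which a common function `a + y / c` vanishes are equal, where `f` has the
same order as `c ^ 2` at `v`. -/
theorem _root_.Place.LiesOver.eq_of_common_zero (h : Place.LiesOver E.cover w v e)
    (h' : Place.LiesOver E.cover w' v e') {c : RatFunc F} (hc : c ≠ 0)
    (hcv : 2 * v.ord c = v.ord (algebraMap F[X] (RatFunc F) E.f)) {a : RatFunc F}
    (hw : w.val (E.cover a + E.y / E.cover c) < 1)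
    (hw' : w'.val (E.cover a + E.y / E.cover c) < 1) : w = w' := by
  have heven : Even (v.ord (algebraMap F[X] (RatFunc F) E.f)) := ⟨v.ord c, by rw [← hcv]; ring⟩
  have he := h.eq_one_of_even heven
  have he' := h'.eq_one_of_even heven
  have hsub : ∀ b, E.cover b + E.y / E.cover c =
      E.cover (b - a) + (E.cover a + E.y / E.cover c) := fun b => by rw [map_sub]; ring
  have key : ∀ b, w.val (E.cover b + E.y / E.cover c) < 1 ↔
      w'.val (E.cover b + E.y / E.cover c) < 1 := by
    intro b
    constructor
    · intro hb
      have h1 := w.val.map_sub_lt hb hw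
      rw [add_sub_add_right_eq_sub, ← map_sub, h.val_lt_one_iff, ← h'.val_lt_one_iff] at h1
      rw [hsub]
      exact w'.val.map_add_lt h1 hw'
    · intro hb
      have h1 := w'.val.map_sub_lt hb hw'
      rw [add_sub_add_right_eq_sub, ← map_sub, h'.val_lt_one_iff, ← h.val_lt_one_iff] at h1
      rw [hsub]
      exact w.val.map_add_lt h1 hw
  refine Place.eq_of_ord_eq fun z hz => ?_
  obtain ⟨r, u, hr, hu, rfl, hcase⟩ := exists_normal_form hc hcv hz
  have hr' : E.cover r ≠ 0 := (_root_.map_ne_zero _).2 hr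
  rw [w.ord_mul hr' hu, w'.ord_mul hr' hu, h.ord, h'.ord, he, he']
  congr 1
  rcases hcase with h0 | ⟨b, hb, rfl⟩
  · rw [h0 w e h, h0 w' e' h']
  · have hk := key b
    rcases h.ord_normal_form hc hcv hb hu with h0 | ⟨h1, h0⟩ <;>
      rcases h'.ord_normal_form hc hcv hb hu with h0' | ⟨h1', h0'⟩
    · rw [h0, h0']
    · rw [← hk, w.val_lt_one_iff hu, h0] at h1'
      exact absurd h1' (lt_irrefl 0)
    · rw [hk, w'.val_lt_one_iff hu, h0'] at h1
      exact absurd h1 (lt_irrefl 0)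
    · rw [h0, h0', he, he']

/-- Two places over the same place of the projective line are equal or conjugate under the
hyperelliptic involution. -/
theorem _root_.Place.LiesOver.eq_or_eq_conjPlace (h : Place.LiesOver E.cover w v e)
    (h' : Place.LiesOver E.cover w' v e') : w' = w ∨ w' = HyperellipticEquation.conjPlace w := by
  rcases Int.even_or_odd (v.ord (algebraMap F[X] (RatFunc F) E.f)) with heven | hodd
  swap
  · exact Or.inl (h'.eq_of_odd h hodd)
  have he := h.eq_one_of_even heven
  have he' := h'.eq_one_of_even heven
  obtain ⟨m, hm⟩ := heven
  obtain ⟨c, hc, hcm⟩ := v.exists_ord_eq m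
  have hcv : 2 * v.ord c = v.ord (algebraMap F[X] (RatFunc F) E.f) := by rw [hcm, hm]; ring
  by_contra! hne
  refine hne.1 (Place.eq_of_ord_eq fun z hz => ?_)
  obtain ⟨r, u, hr, hu, rfl, hcase⟩ := exists_normal_form hc hcv hz
  have hr' : E.cover r ≠ 0 := (_root_.map_ne_zero _).2 hr
  rw [w.ord_mul hr' hu, w'.ord_mul hr' hu, h.ord, h'.ord, he, he']
  congr 1
  rcases hcase with h0 | ⟨b, hb, rfl⟩
  · rw [h0 w e h, h0 w' e' h']
  set u := E.cover b + E.y / E.cover c with hudef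
  -- the function `-(b - y / c)`, again of normal form
  have hconj : E.cover (-b) + E.y / E.cover c = -E.conj u := by
    rw [hudef, map_add, map_div₀, conj_cover, conj_cover, conj_y, map_neg]; ring
  have hcu : E.conj u ≠ 0 := (_root_.map_ne_zero _).2 hu
  have hN : u * E.conj u = E.cover (b ^ 2 - algebraMap F[X] (RatFunc F) E.f / c ^ 2) := by
    have := E.mul_conj b c⁻¹
    rw [map_inv₀, inv_mul_eq_div, inv_pow, inv_mul_eq_div] at this
    exact this
  -- where `u` is a unit above one place, but not above another, its conjugate vanishes there
  have hz' : ∀ (w₁ : Place F E.FunctionField) (e₁ : ℕ), Place.LiesOver E.cover w₁ v e₁ →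
      0 < v.ord (b ^ 2 - algebraMap F[X] (RatFunc F) E.f / c ^ 2) → w₁.ord u = 0 →
      w₁.val (E.conj u) < 1 := by
    intro w₁ e₁ h₁ hpos h0
    rw [w₁.val_lt_one_iff hcu]
    have := w₁.ord_mul hu hcu
    rw [hN, h₁.ord, h0, zero_add] at this
    rw [← this]
    exact mul_pos (by exact_mod_cast h₁.1) hpos
  rcases h.ord_normal_form hc hcv hb hu with h0 | ⟨h1, h0⟩ <;>
    rcases h'.ord_normal_form hc hcv hb hu with h0' | ⟨h1', h0'⟩
  · rw [h0, h0']
  · exfalso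
    have hpos := (w'.val_lt_one_iff hu).1 h1'
    rw [h0', he', Nat.cast_one, one_mul] at hpos
    have := hz' w e h hpos h0
    exact hne.2 (h'.eq_of_common_zero h.conjPlace hc hcv h1' this)
  · exfalso
    have hpos := (w.val_lt_one_iff hu).1 h1
    rw [h0, he, Nat.cast_one, one_mul] at hpos
    have h2 := hz' w' e' h' hpos h0'
    refine hne.2 (h'.eq_of_common_zero (a := -b) h.conjPlace hc hcv ?_ ?_)
    · rw [hconj, Valuation.map_neg]; exact h2
    · rw [hconj, Valuation.map_neg]
      change w.val (E.conj (E.conj u)) < 1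
      rw [conj_conj]; exact h1
  · rw [h0, h0', he, he']

variable (E) in
theorem finite_setOf_liesOver (v : Place F (RatFunc F)) :
    {w : Place F E.FunctionField | ∃ e, Place.LiesOver E.cover w v e}.Finite := by
  obtain ⟨w, e, h⟩ := E.exists_place_over v
  refine ((Set.finite_singleton (conjPlace w)).insert w).subset ?_
  rintro w' ⟨e', h'⟩
  exact h.eq_or_eq_conjPlace h'

/-- A nonzero function has finitely many zeros and poles, since its trace and its norm to `F(x)`
do. -/
theorem finite_setOf_ord_ne_zero {z : E.FunctionField} (hz : z ≠ 0) :
    {w : Place F E.FunctionField | w.ord z ≠ 0}.Finite := by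
  obtain ⟨t, ht⟩ := E.exists_add_conj_eq z
  obtain ⟨n, hn⟩ := E.exists_mul_conj_eq z
  have hcz : E.conj z ≠ 0 := (_root_.map_ne_zero _).2 hz
  refine (((finite_setOf_ratFunc_ord_ne_zero t).union
    (finite_setOf_ratFunc_ord_ne_zero n)).biUnion fun v _ => E.finite_setOf_liesOver v).subset ?_
  intro w (hw : w.ord z ≠ 0)
  obtain ⟨v, e, h⟩ := E.exists_place_under w
  refine Set.mem_biUnion (x := v) ?_ ⟨e, h⟩
  by_contra hv
  have h1 : v.ord t = 0 := not_not.1 fun h' => hv (Or.inl h')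
  have h2 : v.ord n = 0 := not_not.1 fun h' => hv (Or.inr h')
  have hN := w.ord_mul hz hcz
  rw [hn, h.ord, h2, mul_zero] at hN
  have hconj : E.conj z = -z + E.cover t := by rw [← ht]; ring
  have ht' : w.ord (E.cover t) = 0 := by rw [h.ord, h1, mul_zero]
  rcases lt_or_gt_of_ne hw with hlt | hgt
  · have := (w.ord_add_eq_left (b := E.cover t) (neg_ne_zero.2 hz) fun _ => by
      rwa [ht', Place.ord_neg]).2
    rw [← hconj, Place.ord_neg] at this
    omega
  · have : 0 ≤ w.ord (E.conj z) := by
      rw [hconj] at hcz ⊢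
      exact w.le_ord_add hcz (fun _ => by rw [Place.ord_neg]; exact hgt.le) fun _ => ht'.ge
    omega

end Over

end HyperellipticEquation

/-! ### Divisors pulled back from the projective line -/

namespace HyperellipticEquation

variable {F : Type*} [Field F] (E : HyperellipticEquation F)

/-- The order of the pole of `x` at `w`; as a function of `w` this is the pull-back of the point `∞`
of the projective line. -/
noncomputable def poleOrder (w : Place F E.FunctionField) : ℤ := max 0 (-w.ord (E.ofPoly X))

variable {E} {v lam : Place F (RatFunc F)} {w w₀ : Place F E.FunctionField} {e : ℕ} {Q : F[X]}

variable (E) in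
theorem ofPoly_X : E.ofPoly X = E.cover RatFunc.X := by rw [ofPoly, RatFunc.algebraMap_X]

variable (E) in
theorem ofPoly_mul (Q R : F[X]) : E.ofPoly (Q * R) = E.ofPoly Q * E.ofPoly R := by
  simp only [ofPoly, map_mul]

variable (E) in
theorem ofPoly_pow (Q : F[X]) (m : ℕ) : E.ofPoly (Q ^ m) = E.ofPoly Q ^ m := by
  simp only [ofPoly, map_pow]

variable (E) in
theorem ofPoly_add (Q R : F[X]) : E.ofPoly (Q + R) = E.ofPoly Q + E.ofPoly R := by
  simp only [ofPoly, map_add]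

variable (E) in
theorem ofPoly_sub (Q R : F[X]) : E.ofPoly (Q - R) = E.ofPoly Q - E.ofPoly R := by
  simp only [ofPoly, map_sub]

theorem _root_.Place.LiesOver.ord_ofPoly (h : Place.LiesOver E.cover w v e) (Q : F[X]) :
    w.ord (E.ofPoly Q) = e * v.ord (algebraMap F[X] (RatFunc F) Q) := h.ord _

theorem isAtInfinity_iff (h : Place.LiesOver E.cover w v e) :
    E.IsAtInfinity w ↔ v = inftyPlace F := by
  rw [IsAtInfinity, ofPoly_X, h.one_lt_val_iff, one_lt_val_X_iff]

theorem poleOrder_eq (h : Place.LiesOver E.cover w v e) :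
    E.poleOrder w = e * max 0 (-v.ord RatFunc.X) := by
  rw [poleOrder, ofPoly_X, h.ord, mul_max_of_nonneg _ _ (Nat.cast_nonneg e), mul_zero, mul_neg]

theorem poleOrder_of_infty (h : Place.LiesOver E.cover w (inftyPlace F) e) :
    E.poleOrder w = e := by
  classical
  rw [poleOrder_eq h, max_zero_neg_ord_X, if_pos rfl, mul_one]

theorem poleOrder_of_affine (h : Place.LiesOver E.cover w v e) (hv : v.val RatFunc.X ≤ 1) :
    E.poleOrder w = 0 := by
  rw [v.val_le_one_iff RatFunc.X_ne_zero] at hv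
  rw [poleOrder_eq h, max_eq_left (by omega), mul_zero]

theorem pullbackDivisor_cover_infty (m : ℤ) :
    pullbackDivisor E.cover (Finsupp.single (inftyPlace F) m) w = m * E.poleOrder w := by
  classical
  obtain ⟨v, e, h⟩ := E.exists_place_under w
  rw [h.pullbackDivisor_apply, poleOrder_eq h, max_zero_neg_ord_X, Finsupp.single_apply]
  by_cases hv : v = inftyPlace F
  · rw [if_pos hv, if_pos hv.symm]; ring
  · rw [if_neg hv, if_neg (Ne.symm hv)]; ring

theorem pullbackDivisor_cover_minpoly (hlam : IsAffinePointWithMinpoly lam Q) :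
    pullbackDivisor E.cover (Finsupp.single lam 1) w =
      w.ord (E.ofPoly Q) + Q.natDegree * E.poleOrder w := by
  classical
  obtain ⟨v, e, h⟩ := E.exists_place_under w
  rw [h.pullbackDivisor_apply, poleOrder_eq h, h.ord_ofPoly, hlam.ord_minpoly_apply,
    Finsupp.single_apply]
  by_cases hv : v = lam
  · rw [if_pos hv, if_pos hv.symm]; ring
  · rw [if_neg hv, if_neg (Ne.symm hv)]; ring

theorem pullbackDivisor_cover_of_odd (h₀ : Place.LiesOver E.cover w₀ v e)
    (hodd : Odd (v.ord (algebraMap F[X] (RatFunc F) E.f))) (m : ℤ) :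
    pullbackDivisor E.cover (Finsupp.single v m) w = Finsupp.single w₀ (2 * m) w := by
  classical
  obtain ⟨v', e', h⟩ := E.exists_place_under w
  rw [h.pullbackDivisor_apply, Finsupp.single_apply, Finsupp.single_apply]
  by_cases hv : v = v'
  · subst hv
    rw [if_pos rfl, if_pos (h₀.eq_of_odd h hodd), h.eq_two_of_odd hodd]; rfl
  · rw [if_neg hv, if_neg, mul_zero]
    rintro rfl
    exact hv (h₀.unique h).1

variable (E) in
/-- The pull-back of a divisor on the projective line is a divisor: its support is finite. -/
theorem exists_divisor_eq_pullback (D : CurveDivisor F (RatFunc F)) :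
    ∃ L : CurveDivisor F E.FunctionField, ⇑L = pullbackDivisor E.cover D := by
  have hfin : (Function.support fun w : Place F E.FunctionField =>
      pullbackDivisor E.cover D w).Finite := by
    refine (D.support.finite_toSet.biUnion fun v _ => E.finite_setOf_liesOver v).subset ?_
    intro w hw
    obtain ⟨v, e, h⟩ := E.exists_place_under w
    rw [Function.mem_support, h.pullbackDivisor_apply] at hw
    exact Set.mem_biUnion (x := v) (Finsupp.mem_support_iff.2 (right_ne_zero_of_mul hw)) ⟨e, h⟩
  exact ⟨Finsupp.ofSupportFinite _ hfin, Finsupp.ofSupportFinite_coe⟩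

theorem finite_support_poleOrder : {w : Place F E.FunctionField | E.poleOrder w ≠ 0}.Finite := by
  refine (finite_setOf_ord_ne_zero (E.ofPoly_ne_zero X_ne_zero)).subset ?_
  intro w (hw : E.poleOrder w ≠ 0) (h0 : w.ord _ = 0)
  rw [poleOrder, h0] at hw
  simp at hw

theorem _root_.IsAffinePointWithMinpoly.ord_f (hv : IsAffinePointWithMinpoly v Q) (hQ : Q ∣ E.f) :
    v.ord (algebraMap F[X] (RatFunc F) E.f) = 1 :=
  hv.ord_of_squarefree E.separable.squarefree hQ

/-- A branch point of the double covering is doubled when pulled back. -/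
theorem two_mul_single_branch (h₀ : Place.LiesOver E.cover w₀ v e)
    (hv : IsAffinePointWithMinpoly v Q) (hQ : Q ∣ E.f) :
    2 * Finsupp.single w₀ (1 : ℤ) w = w.ord (E.ofPoly Q) + Q.natDegree * E.poleOrder w := by
  rw [← pullbackDivisor_cover_minpoly hv,
    pullbackDivisor_cover_of_odd h₀ (by rw [hv.ord_f hQ]; exact odd_one)]
  classical
  rw [Finsupp.single_apply, Finsupp.single_apply]
  split_ifs <;> rfl

theorem isAffinePointWithMinpoly_X_sub_C_iff {a : F} :
    IsAffinePointWithMinpoly v (X - C a) ↔ v.val (algebraMap F[X] (RatFunc F) (X - C a)) < 1 := by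
  refine ⟨fun h => (h.2.2 _).2 dvd_rfl, fun h => ?_⟩
  have hX : v.val RatFunc.X ≤ 1 := by
    by_contra hlt
    rw [v.val_lt_one_iff (algebraMap_ratFunc_ne_zero (X_sub_C_ne_zero a)),
      one_lt_val_X_iff.1 (not_le.1 hlt), ord_inftyPlace_polynomial, natDegree_X_sub_C] at h
    omega
  obtain ⟨Q, hQ⟩ := exists_isAffinePointWithMinpoly hX
  rw [← hQ.eq_of_dvd (irreducible_X_sub_C a) (monic_X_sub_C a) ((hQ.2.2 _).1 h)]
  exact hQ

/-- For a root `a` of `f`, the point `(a, 0)` is the only place over `a`. -/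
theorem exists_isPoint_iff {a : F} (ha : E.f.IsRoot a) :
    ∃ (T : Place F E.FunctionField) (v : Place F (RatFunc F)) (e : ℕ),
      IsAffinePointWithMinpoly v (X - C a) ∧ Place.LiesOver E.cover T v e ∧
      ∀ w, E.IsPoint w a 0 ↔ w = T := by
  obtain ⟨v, hv⟩ := exists_place_of_irreducible (irreducible_X_sub_C a) (monic_X_sub_C a)
  obtain ⟨T, e, hT⟩ := E.exists_place_over v
  have hd := dvd_iff_isRoot.2 ha
  have hodd : Odd (v.ord (algebraMap F[X] (RatFunc F) E.f)) := by
    rw [hv.ord_f hd]; exact odd_one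
  refine ⟨T, v, e, hv, hT, fun w => ⟨fun hw => ?_, ?_⟩⟩
  · obtain ⟨v', e', h⟩ := E.exists_place_under w
    have h1 := hw.1
    rw [ofPoly, h.val_lt_one_iff, ← isAffinePointWithMinpoly_X_sub_C_iff] at h1
    have := h1.eq hv
    subst this
    exact h.eq_of_odd hT hodd
  · rintro rfl
    refine ⟨?_, ?_⟩
    · rw [ofPoly, hT.val_lt_one_iff, ← isAffinePointWithMinpoly_X_sub_C_iff]; exact hv
    · have h2 := hT.two_mul_ord_y
      rw [hv.ord_f hd] at h2
      have he := hT.1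
      have h0 : E.ofPoly (C 0) = 0 := by simp [ofPoly]
      rw [h0, sub_zero, w.val_lt_one_iff E.y_ne_zero]
      omega

/-! ### Extension of the field of constants -/

section BaseChange

variable (E) (F' : Type*) [Field F'] [Algebra F F']

theorem toBaseChange_cover (a : RatFunc F) :
    E.toBaseChange F' (E.cover a) = (E.baseChange F').cover (ratFuncBaseChange F F' a) :=
  AdjoinRoot.lift_of _

theorem toBaseChange_comp_cover :
    (E.toBaseChange F').comp E.cover = ((E.baseChange F').cover).comp (ratFuncBaseChange F F') :=
  RingHom.ext (E.toBaseChange_cover F')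

@[simp] theorem toBaseChange_y : E.toBaseChange F' E.y = (E.baseChange F').y :=
  AdjoinRoot.lift_root _

theorem toBaseChange_ofPoly (Q : F[X]) :
    E.toBaseChange F' (E.ofPoly Q) = (E.baseChange F').ofPoly (Q.map (algebraMap F F')) := by
  rw [ofPoly, toBaseChange_cover, ratFuncBaseChange_algebraMap]; rfl

theorem _root_.ratFuncBaseChange_algebraMap_const (a : F) :
    ratFuncBaseChange F F' (algebraMap F (RatFunc F) a) =
      algebraMap F' (RatFunc F') (algebraMap F F' a) := by
  rw [IsScalarTower.algebraMap_apply F F[X] (RatFunc F), ratFuncBaseChange_algebraMap,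
    Polynomial.algebraMap_eq, map_C, IsScalarTower.algebraMap_apply F' F'[X] (RatFunc F'),
    Polynomial.algebraMap_eq]

variable {E F'} in
theorem poleOrder_toBaseChange {w : Place F' (E.baseChange F').FunctionField}
    {v : Place F E.FunctionField} (h : Place.LiesOver (E.toBaseChange F') w v 1) :
    (E.baseChange F').poleOrder w = E.poleOrder v := by
  rw [poleOrder, poleOrder]
  have := h.ord (E.ofPoly X)
  rw [toBaseChange_ofPoly, Polynomial.map_X, Nat.cast_one, one_mul] at this
  rw [this]

variable {F'} [IsAlgClosed F'] [Algebra.IsSeparable F F']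

/-- The projective line over `F'` is unramified over that over `F`: the minimal polynomial over `F`
of an element of `F'` has simple roots. -/
theorem _root_.exists_liesOver_ratFuncBaseChange (w : Place F' (RatFunc F')) :
    ∃ v : Place F (RatFunc F), Place.LiesOver (ratFuncBaseChange F F') w v 1 := by
  obtain ⟨Q, hQ⟩ : ∃ Q : F[X], w.ord (ratFuncBaseChange F F' (algebraMap F[X] (RatFunc F) Q)) = 1 ∨
      w.ord (ratFuncBaseChange F F' (algebraMap F[X] (RatFunc F) Q)) = -1 := by
    by_cases hX : w.val RatFunc.X ≤ 1
    · obtain ⟨R, hR⟩ := exists_isAffinePointWithMinpoly hX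
      obtain ⟨a, ha⟩ := IsAlgClosed.exists_root R
        (degree_pos_of_irreducible hR.prime.irreducible).ne'
      have hRa : R = X - C a := (eq_of_monic_of_associated (monic_X_sub_C a) hR.2.1
        ((irreducible_X_sub_C a).associated_of_dvd hR.prime.irreducible
          (dvd_iff_isRoot.2 ha))).symm
      have hd : R ∣ (minpoly F a).map (algebraMap F F') := by
        rw [hRa, dvd_iff_isRoot, IsRoot, eval_map_algebraMap, minpoly.aeval]
      have hsep : ((minpoly F a).map (algebraMap F F')).Separable :=
        Polynomial.Separable.map (Algebra.IsSeparable.isSeparable F a)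
      refine ⟨minpoly F a, Or.inl ?_⟩
      rw [ratFuncBaseChange_algebraMap]
      exact hR.ord_of_squarefree hsep.squarefree hd
    · refine ⟨X, Or.inr ?_⟩
      rw [ratFuncBaseChange_algebraMap, Polynomial.map_X, eq_inftyPlace (not_le.1 hX),
        ord_inftyPlace_polynomial, natDegree_X, Nat.cast_one]
  obtain ⟨v, e, h⟩ := Place.exists_liesOver (ratFuncBaseChange F F') w
    (fun a _ => by rw [ratFuncBaseChange_algebraMap_const, w.ord_algebraMap])
    ⟨_, by rcases hQ with hQ | hQ <;> rw [hQ] <;> decide⟩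
  have he : e = 1 := by
    rw [h.ord] at hQ
    have : (e : ℤ) ∣ 1 := by
      rcases hQ with hQ | hQ
      · exact ⟨_, hQ.symm⟩
      · exact ⟨-_, by rw [mul_neg, hQ, neg_neg]⟩
    exact Nat.dvd_one.1 (by exact_mod_cast this)
  exact ⟨v, he ▸ h⟩

/-- A hyperelliptic curve over `F'` obtained by base change is unramified over the curve over `F`:
the ramification over the projective line is governed by the order of `f`, which does not change. -/
theorem exists_liesOver_toBaseChange (w : Place F' (E.baseChange F').FunctionField) :
    ∃ v : Place F E.FunctionField, Place.LiesOver (E.toBaseChange F') w v 1 := by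
  obtain ⟨w₀, e₀, h₀⟩ := (E.baseChange F').exists_place_under w
  obtain ⟨v₁, h₁⟩ := exists_liesOver_ratFuncBaseChange (F := F) w₀
  have h₂ := h₁.trans h₀
  rw [mul_one, ← toBaseChange_comp_cover] at h₂
  obtain ⟨v, e', h⟩ := Place.exists_liesOver (E.toBaseChange F') w
    (fun a _ => by
      rw [← cover_algebraMap, toBaseChange_cover, ratFuncBaseChange_algebraMap_const,
        cover_algebraMap, w.ord_algebraMap])
    (by
      obtain ⟨a, -, ha⟩ := v₁.exists_ord_eq 1
      refine ⟨E.cover a, ?_⟩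
      have := h₂.ord a
      rw [ha, mul_one, RingHom.comp_apply] at this
      rw [this]
      exact_mod_cast h₀.1.ne')
  obtain ⟨v₂, e₂, h₃⟩ := E.exists_place_under v
  obtain ⟨rfl, hee⟩ := (h₃.trans h).unique h₂
  have hf : w₀.ord (algebraMap F'[X] (RatFunc F') (E.baseChange F').f) =
      v₂.ord (algebraMap F[X] (RatFunc F) E.f) := by
    have := h₁.ord (algebraMap F[X] (RatFunc F) E.f)
    rw [ratFuncBaseChange_algebraMap, Nat.cast_one, one_mul] at this
    exact this
  have he : e₂ = e₀ := by
    rcases Int.even_or_odd (v₂.ord (algebraMap F[X] (RatFunc F) E.f)) with hp | hp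
    · rw [h₃.eq_one_of_even hp, h₀.eq_one_of_even (hf ▸ hp)]
    · rw [h₃.eq_two_of_odd hp, h₀.eq_two_of_odd (hf ▸ hp)]
  rw [he] at hee
  have : e' = 1 := Nat.eq_of_mul_eq_mul_right h₀.1 (by rw [hee, one_mul])
  exact ⟨v, this ▸ h⟩

end BaseChange

end HyperellipticEquation

/-! ### Functions with prescribed parity of their divisor -/

theorem Polynomial.exists_squarefree_mul_sq {F : Type*} [Field F] {R : F[X]} (hR : R ≠ 0) :
    ∃ G S : F[X], Squarefree G ∧ S ≠ 0 ∧ R = G * S ^ 2 := by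
  induction h : R.natDegree using Nat.strong_induction_on generalizing R with
  | _ n ih =>
    by_cases hsq : Squarefree R
    · exact ⟨R, 1, hsq, one_ne_zero, by ring⟩
    · rw [Squarefree] at hsq
      push Not at hsq
      obtain ⟨p, ⟨q, rfl⟩, hp⟩ := hsq
      have hq : q ≠ 0 := right_ne_zero_of_mul hR
      have hp0 : p ≠ 0 := left_ne_zero_of_mul (left_ne_zero_of_mul hR)
      have hdeg : 0 < p.natDegree := natDegree_pos_iff_degree_pos.2 (degree_pos_of_ne_zero_of_nonunit hp0 hp)
      obtain ⟨G, S, hG, hS, rfl⟩ := ih q.natDegree (by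
        rw [← h, natDegree_mul (mul_ne_zero hp0 hp0) hq, natDegree_mul hp0 hp0]; omega) hq rfl
      exact ⟨G, p * S, hG, mul_ne_zero hp0 hS, by ring⟩

theorem Polynomial.even_natDegree_of_forall_irreducible {F : Type*} [Field F] {G : F[X]}
    (hG : G ≠ 0) (h : ∀ p, p.Monic → Irreducible p → p ∣ G → Even p.natDegree) :
    Even G.natDegree := by
  induction hn : G.natDegree using Nat.strong_induction_on generalizing G with
  | _ n ih =>
    by_cases hu : IsUnit G
    · rw [← hn, natDegree_eq_zero_of_isUnit hu]; exact Even.zero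
    · obtain ⟨p, hm, hp, q, rfl⟩ := exists_monic_irreducible_factor G hu
      have hq : q ≠ 0 := right_ne_zero_of_mul hG
      rw [natDegree_mul hm.ne_zero hq] at hn
      have hpos := hp.natDegree_pos
      have hpe := h p hm hp (dvd_mul_right _ _)
      rw [← hn]
      exact hpe.add (ih _ (by omega) hq (fun r hr hr' hd => h r hr hr' (hd.mul_left p)) rfl)

/-- Up to squares, a nonzero rational function is a squarefree polynomial. -/
theorem RatFunc.exists_squarefree_mul_sq {F : Type*} [Field F] {a : RatFunc F} (ha : a ≠ 0) :
    ∃ (G : F[X]) (b : RatFunc F), Squarefree G ∧ b ≠ 0 ∧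
      a = algebraMap F[X] (RatFunc F) G * b ^ 2 := by
  obtain ⟨p, q, hq, rfl⟩ := IsFractionRing.div_surjective (A := F[X]) a
  have hq0 : q ≠ 0 := nonZeroDivisors.ne_zero hq
  have hp0 : p ≠ 0 := by rintro rfl; simp at ha
  obtain ⟨G, S, hG, hS, h⟩ := Polynomial.exists_squarefree_mul_sq (mul_ne_zero hp0 hq0)
  have hq1 := algebraMap_ratFunc_ne_zero hq0
  refine ⟨G, algebraMap F[X] (RatFunc F) S / algebraMap F[X] (RatFunc F) q, hG,
    div_ne_zero (algebraMap_ratFunc_ne_zero hS) hq1, ?_⟩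
  have := congrArg (algebraMap F[X] (RatFunc F)) h
  rw [map_mul, map_mul, map_pow] at this
  field_simp
  exact this

namespace HyperellipticEquation

variable {F : Type*} [Field F] (E : HyperellipticEquation F)

/-- If the divisor of a function is even on the affine part of the curve, its norm to `F(x)` is a
constant times a square. -/
theorem norm_eq_const_mul_sq {H : E.FunctionField} (hH : H ≠ 0)
    (heven : ∀ w, E.poleOrder w = 0 → Even (w.ord H)) {N : RatFunc F}
    (hN : H * E.conj H = E.cover N) :
    ∃ (c : F) (b : RatFunc F), c ≠ 0 ∧ b ≠ 0 ∧ N = algebraMap F (RatFunc F) c * b ^ 2 := by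
  have hH' : E.conj H ≠ 0 := (_root_.map_ne_zero _).2 hH
  have hN0 : N ≠ 0 := by
    rintro rfl
    rw [map_zero] at hN
    exact mul_ne_zero hH hH' hN
  obtain ⟨G, b, hG, hb, rfl⟩ := RatFunc.exists_squarefree_mul_sq hN0
  have hG1 := algebraMap_ratFunc_ne_zero hG.ne_zero
  have hunit : IsUnit G := by
    by_contra hu
    obtain ⟨p, hm, hp, hpG⟩ := exists_monic_irreducible_factor G hu
    obtain ⟨v, hv⟩ := exists_place_of_irreducible hp hm
    obtain ⟨w, e, h⟩ := E.exists_place_over v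
    have hord := w.ord_mul hH hH'
    rw [hN, h.ord, v.ord_mul hG1 (pow_ne_zero _ hb), Place.ord_pow, hv.ord_of_squarefree hG hpG]
      at hord
    obtain ⟨m, hm⟩ := heven w (poleOrder_of_affine h hv.1)
    obtain ⟨m', hm'⟩ := heven (conjPlace w) (poleOrder_of_affine h.conjPlace hv.1)
    rcases Int.even_or_odd (v.ord (algebraMap F[X] (RatFunc F) E.f)) with hpar | hpar
    · rw [ord_conjPlace] at hm'
      rw [h.eq_one_of_even hpar, hm, hm'] at hord
      push_cast at hord
      omega
    · rw [h.conjPlace.eq_of_odd h hpar] at hm'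
      rw [← ord_conjPlace, h.conjPlace.eq_of_odd h hpar, h.eq_two_of_odd hpar, hm] at hord
      push_cast at hord
      omega
  obtain ⟨c, hc, rfl⟩ := Polynomial.isUnit_iff.1 hunit
  refine ⟨c, b, hc.ne_zero, hb, ?_⟩
  rw [IsScalarTower.algebraMap_apply F F[X] (RatFunc F), Polynomial.algebraMap_eq]

/-- Hilbert's theorem 90 for the double covering: a function whose norm is a square in `F(x)` is the
product of a square and a function of `x`. -/
theorem exists_eq_cover_mul_sq {H : E.FunctionField} {b : RatFunc F} (hb : b ≠ 0)
    (hN : H * E.conj H = E.cover (b ^ 2)) :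
    ∃ (r : RatFunc F) (s : E.FunctionField), r ≠ 0 ∧ s ≠ 0 ∧ H = E.cover r * s ^ 2 := by
  have hb' : E.cover b ≠ 0 := (_root_.map_ne_zero _).2 hb
  by_cases h1 : E.cover b + H = 0
  · exact ⟨-b, 1, neg_ne_zero.2 hb, one_ne_zero, by
      rw [map_neg, one_pow, mul_one]; exact (neg_eq_of_add_eq_zero_right h1).symm⟩
  obtain ⟨n, hn⟩ := E.exists_mul_conj_eq (E.cover b + H)
  have hn0 : n ≠ 0 := by
    rintro rfl
    rw [map_zero] at hn
    exact mul_ne_zero h1 ((_root_.map_ne_zero _).2 h1) hn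
  have hn' : E.cover n ≠ 0 := (_root_.map_ne_zero _).2 hn0
  refine ⟨b / n, E.cover b + H, div_ne_zero hb hn0, h1, ?_⟩
  rw [map_div₀, div_mul_eq_mul_div, eq_div_iff hn', ← hn, map_add, conj_cover]
  rw [map_pow] at hN
  linear_combination (E.cover b + H) * hN

/-- If all irreducible factors of `f` have even degree, then no function whose norm is a square in
`F(x)` has a divisor congruent to the pull-back of `∞` modulo `2`. -/
theorem not_forall_even_of_norm_sq (hf : ∀ p, p.Monic → Irreducible p → p ∣ E.f → Even p.natDegree)
    {H : E.FunctionField} {b : RatFunc F} (hb : b ≠ 0) (hN : H * E.conj H = E.cover (b ^ 2)) :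
    ¬ ∀ w, Even (w.ord H - E.poleOrder w) := by
  intro hpar
  obtain ⟨r, s, hr, hs, rfl⟩ := E.exists_eq_cover_mul_sq hb hN
  obtain ⟨G, b', hG, hb', rfl⟩ := RatFunc.exists_squarefree_mul_sq hr
  have hG1 := algebraMap_ratFunc_ne_zero hG.ne_zero
  have key : ∀ (w : Place F E.FunctionField) (v : Place F (RatFunc F)) (e : ℕ), Place.LiesOver E.cover w v e →
      Even (e * v.ord (algebraMap F[X] (RatFunc F) G) - E.poleOrder w) := by
    intro w v e h
    obtain ⟨m, hm⟩ := hpar w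
    rw [w.ord_mul ((_root_.map_ne_zero _).2 hr) (pow_ne_zero _ hs), h.ord,
      v.ord_mul hG1 (pow_ne_zero _ hb'), Place.ord_pow, Place.ord_pow] at hm
    refine ⟨m - e * v.ord b' - w.ord s, ?_⟩
    push_cast at hm
    linarith
  have hdeg : Even G.natDegree := by
    refine even_natDegree_of_forall_irreducible hG.ne_zero fun p hm hp hpG => ?_
    obtain ⟨v, hv⟩ := exists_place_of_irreducible hp hm
    obtain ⟨w, e, h⟩ := E.exists_place_over v
    have h1 := key w v e h
    rw [poleOrder_of_affine h hv.1, hv.ord_of_squarefree hG hpG, mul_one, sub_zero] at h1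
    refine hf p hm hp ?_
    by_contra hpf
    rw [h.eq_one_of_even (by rw [hv.ord_eq_zero hpf]; exact Even.zero)] at h1
    exact absurd h1 (by decide)
  have hfdeg := even_natDegree_of_forall_irreducible E.f_ne_zero hf
  obtain ⟨w, e, h⟩ := E.exists_place_over (inftyPlace F)
  have he : e = 1 := h.eq_one_of_even (by
    rw [ord_inftyPlace_polynomial, even_neg]; exact_mod_cast hfdeg)
  have h1 := key w _ e h
  rw [poleOrder_of_infty h, he, ord_inftyPlace_polynomial] at h1
  obtain ⟨m, hm⟩ := hdeg
  obtain ⟨m', hm'⟩ := h1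
  rw [hm] at hm'
  push_cast at hm'
  omega

/-! ### The function `Q + 2 y` -/

section HalfFunction

variable {E} {Q h : F[X]} {c : F}

variable (E) in
theorem conj_ofPoly_add_two_mul_y (Q : F[X]) :
    E.conj (E.ofPoly Q + 2 * E.y) = E.ofPoly Q - 2 * E.y := by
  rw [map_add, map_mul, conj_ofPoly, conj_y, map_ofNat]; ring

variable (E) in
theorem functionField_two_ne_zero : (2 : E.FunctionField) ≠ 0 := by
  have := E.cover_two_ne_zero
  rwa [map_ofNat] at this

variable (E) in
theorem ofPoly_add_y_ne_zero (Q : F[X]) : E.ofPoly Q + E.y ≠ 0 := by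
  intro h
  have h1 : E.ofPoly Q - E.y = 0 := by
    rw [← map_zero E.conj, ← h, map_add, conj_ofPoly, conj_y, sub_eq_add_neg]
  refine mul_ne_zero E.functionField_two_ne_zero E.y_ne_zero ?_
  linear_combination h - h1

variable (E) in
theorem ofPoly_add_two_mul_y_ne_zero (Q : F[X]) : E.ofPoly Q + 2 * E.y ≠ 0 := by
  intro h
  have h1 := E.conj_ofPoly_add_two_mul_y Q
  rw [h, map_zero] at h1
  refine mul_ne_zero (mul_ne_zero E.functionField_two_ne_zero E.functionField_two_ne_zero)
    E.y_ne_zero ?_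
  linear_combination h + h1

theorem ofPoly_add_two_mul_y_norm (hQ : Q ^ 2 - 4 * E.f = C c * h ^ 2) :
    (E.ofPoly Q + 2 * E.y) * E.conj (E.ofPoly Q + 2 * E.y) =
      E.cover (algebraMap F (RatFunc F) c * algebraMap F[X] (RatFunc F) h ^ 2) := by
  have h1 : E.ofPoly (Q ^ 2 - 4 * E.f) = E.ofPoly (C c * h ^ 2) := by rw [hQ]
  have h4 : E.ofPoly 4 = 4 := by rw [ofPoly, map_ofNat, map_ofNat]
  rw [ofPoly_sub, ofPoly_pow, ofPoly_mul, h4, ← E.y_sq] at h1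
  rw [conj_ofPoly_add_two_mul_y, IsScalarTower.algebraMap_apply F F[X] (RatFunc F),
    Polynomial.algebraMap_eq, ← map_pow, ← map_mul]
  change _ = E.ofPoly _
  rw [← h1]; ring

/-- The function `Q + 2 y`, whose norm is a constant times a square, has an even divisor up to
`g + 1` times the pull-back of `∞`: at each place, either it or its conjugate has the least order
that the orders of `Q` and `y` permit, so its own order is known modulo `2`. -/
theorem even_ord_ofPoly_add_two_mul_y {g : ℕ} (hf : E.f.natDegree = 2 * g + 2)
    (hQd : Q.natDegree = g + 1) (hc : c ≠ 0) (hh : h ≠ 0) (hQ : Q ^ 2 - 4 * E.f = C c * h ^ 2)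
    (hcop : IsCoprime Q E.f) (w : Place F E.FunctionField) :
    Even (w.ord (E.ofPoly Q + 2 * E.y) + (g + 1) * E.poleOrder w) := by
  obtain ⟨v, e, hv⟩ := E.exists_place_under w
  have hu := E.ofPoly_add_two_mul_y_ne_zero Q
  have hu' : E.conj (E.ofPoly Q + 2 * E.y) ≠ 0 := (_root_.map_ne_zero _).2 hu
  have hQ0 : Q ≠ 0 := by rintro rfl; simp at hQd
  have hnorm := w.ord_mul hu hu'
  have hc' : algebraMap F (RatFunc F) c ≠ 0 := (_root_.map_ne_zero _).2 hc
  have hh' := algebraMap_ratFunc_ne_zero hh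
  rw [ofPoly_add_two_mul_y_norm hQ, hv.ord, v.ord_mul hc' (pow_ne_zero _ hh'), v.ord_algebraMap,
    Place.ord_pow, zero_add] at hnorm
  have hconj : E.conj (E.ofPoly Q + 2 * E.y) = 2 * E.ofPoly Q + -(E.ofPoly Q + 2 * E.y) := by
    rw [conj_ofPoly_add_two_mul_y]; ring
  have h2 : w.ord (2 : E.FunctionField) = 0 := by
    rw [show (2 : E.FunctionField) = algebraMap F E.FunctionField 2 from (map_ofNat _ 2).symm,
      w.ord_algebraMap]
  have h2Q : 2 * E.ofPoly Q ≠ 0 := mul_ne_zero E.functionField_two_ne_zero (E.ofPoly_ne_zero hQ0)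
  have h2y : 2 * E.y ≠ 0 := mul_ne_zero E.functionField_two_ne_zero E.y_ne_zero
  have ho2Q : w.ord (2 * E.ofPoly Q) = w.ord (E.ofPoly Q) := by
    rw [w.ord_mul E.functionField_two_ne_zero (E.ofPoly_ne_zero hQ0), h2, zero_add]
  have ho2y : w.ord (2 * E.y) = w.ord E.y := by
    rw [w.ord_mul E.functionField_two_ne_zero E.y_ne_zero, h2, zero_add]
  have hy := hv.two_mul_ord_y
  by_cases hinf : v = inftyPlace F
  · subst hinf
    have he : e = 1 := hv.eq_one_of_even (by
      rw [ord_inftyPlace_polynomial, even_neg, hf]; exact ⟨g + 1, by push_cast; ring⟩)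
    subst he
    rw [ord_inftyPlace_polynomial, hf] at hy
    have hoQ := hv.ord_ofPoly Q
    rw [ord_inftyPlace_polynomial, hQd] at hoQ
    push_cast at hy hoQ hnorm
    rw [poleOrder_of_infty hv, Nat.cast_one, mul_one]
    have hge : -((g : ℤ) + 1) ≤ w.ord (E.ofPoly Q + 2 * E.y) :=
      w.le_ord_add hu (fun _ => by omega) fun _ => by omega
    rcases hge.eq_or_lt with heq | hlt
    · rw [← heq]; exact ⟨0, by ring⟩
    · have h1 := (w.ord_add_eq_left h2Q (b := -(E.ofPoly Q + 2 * E.y)) fun _ => by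
        rw [Place.ord_neg, ho2Q]; omega).2
      rw [← hconj, ho2Q] at h1
      exact ⟨(inftyPlace F).ord (algebraMap F[X] (RatFunc F) h) + (g + 1), by omega⟩
  · have hX : v.val RatFunc.X ≤ 1 := not_lt.1 fun h' => hinf (one_lt_val_X_iff.1 h')
    rw [poleOrder_of_affine hv hX, mul_zero, add_zero]
    have hpoly : ∀ R, 0 ≤ w.ord (E.ofPoly R) := fun R => by
      rw [hv.ord_ofPoly]
      exact mul_nonneg (Nat.cast_nonneg _) (v.ord_polynomial_nonneg hX R)
    have hy0 : 0 ≤ w.ord E.y := by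
      have := hpoly E.f
      rw [hv.ord_ofPoly, ← hy] at this
      omega
    have hge : 0 ≤ w.ord (E.ofPoly Q + 2 * E.y) :=
      w.le_ord_add hu (fun _ => hpoly Q) fun _ => by omega
    rcases hge.eq_or_lt with heq | hlt
    · rw [← heq]; exact Even.zero
    have hge' : 0 ≤ w.ord (E.conj (E.ofPoly Q + 2 * E.y)) := by
      rw [hconj] at hu' ⊢
      exact w.le_ord_add hu' (fun _ => by rw [ho2Q]; exact hpoly Q) fun _ => by
        rw [Place.ord_neg]; exact hge
    rcases hge'.eq_or_lt with heq' | hlt'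
    · rw [← heq', add_zero] at hnorm
      rw [← hnorm]
      exact ⟨e * v.ord (algebraMap F[X] (RatFunc F) h), by push_cast; ring⟩
    exfalso
    have hv1 := (w.val_lt_one_iff hu).2 hlt
    have hv2 := (w.val_lt_one_iff hu').2 hlt'
    have hQ1 : w.val (E.ofPoly Q) < 1 := by
      have := w.val.map_add_lt hv1 hv2
      rw [hconj, show E.ofPoly Q + 2 * E.y + (2 * E.ofPoly Q + -(E.ofPoly Q + 2 * E.y)) =
        2 * E.ofPoly Q by ring, w.val_lt_one_iff h2Q, ho2Q] at this
      exact (w.val_lt_one_iff (E.ofPoly_ne_zero hQ0)).2 this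
    have hy1 : w.val E.y < 1 := by
      have := w.val.map_sub_lt hv1 hQ1
      rw [show E.ofPoly Q + 2 * E.y - E.ofPoly Q = 2 * E.y by ring, w.val_lt_one_iff h2y,
        ho2y] at this
      exact (w.val_lt_one_iff E.y_ne_zero).2 this
    have hf1 : w.val (E.ofPoly E.f) < 1 := by
      rw [← E.y_sq, map_pow]
      exact pow_lt_one₀ zero_le hy1 (by norm_num)
    have hle : ∀ R, w.val (E.ofPoly R) ≤ 1 := fun R => by
      rw [ofPoly, hv.val_le_one_iff]; exact v.val_polynomial_le_one hX R
    obtain ⟨a, b, hab⟩ := hcop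
    have h1 : w.val (E.ofPoly (a * Q + b * E.f)) < 1 := by
      rw [ofPoly_add, ofPoly_mul, ofPoly_mul]
      refine w.val.map_add_lt ?_ ?_ <;> rw [map_mul]
      · exact (mul_le_of_le_one_left' (hle a)).trans_lt hQ1
      · exact (mul_le_of_le_one_left' (hle b)).trans_lt hf1
    rw [hab, show E.ofPoly 1 = 1 by simp [ofPoly], map_one] at h1
    exact lt_irrefl _ h1

/-- If all irreducible factors of `f` have even degree and `g` is odd, no function has a divisor
congruent to the pull-back of `∞` modulo `2`, over a finite field: its norm is a constant times a
square, and multiplication by `Q + 2 y` changes the class of this constant modulo squares. -/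
theorem not_forall_even_ord_sub_poleOrder [Finite F] {g : ℕ} (hg : Odd g)
    (hf : ∀ p, p.Monic → Irreducible p → p ∣ E.f → Even p.natDegree)
    (hfd : E.f.natDegree = 2 * g + 2) (hQd : Q.natDegree = g + 1) (hc : ¬ IsSquare c)
    (hh : h ≠ 0) (hQ : Q ^ 2 - 4 * E.f = C c * h ^ 2) (hcop : IsCoprime Q E.f)
    {H : E.FunctionField} (hH : H ≠ 0) : ¬ ∀ w, Even (w.ord H - E.poleOrder w) := by
  intro hpar
  have hc0 : c ≠ 0 := by rintro rfl; exact hc ⟨0, by ring⟩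
  obtain ⟨N, hN⟩ := E.exists_mul_conj_eq H
  obtain ⟨c', b, hc', hb, rfl⟩ := E.norm_eq_const_mul_sq hH (fun w hw => by
    have := hpar w
    rwa [hw, sub_zero] at this) hN
  by_cases hsq : IsSquare c'
  · obtain ⟨a, rfl⟩ := hsq
    have ha : algebraMap F (RatFunc F) a ≠ 0 := (_root_.map_ne_zero _).2 (left_ne_zero_of_mul hc')
    refine E.not_forall_even_of_norm_sq hf (mul_ne_zero ha hb) ?_ hpar
    rw [hN, map_mul (algebraMap F (RatFunc F))]; congr 1; ring
  · obtain ⟨a, ha⟩ : IsSquare (c' * c) := by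
      have := Fintype.ofFinite F
      classical
      by_cases hp : ringChar F = 2
      · exact FiniteField.isSquare_of_char_two hp _
      rw [← quadraticChar_one_iff_isSquare (mul_ne_zero hc' hc0), map_mul,
        quadraticChar_neg_one_iff_not_isSquare.2 hsq, quadraticChar_neg_one_iff_not_isSquare.2 hc]
      norm_num
    have ha0 : a ≠ 0 := by
      rintro rfl
      rw [mul_zero] at ha
      exact mul_ne_zero hc' hc0 ha
    have ha' : algebraMap F (RatFunc F) a ≠ 0 := (_root_.map_ne_zero _).2 ha0
    have hu := E.ofPoly_add_two_mul_y_ne_zero Q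
    refine E.not_forall_even_of_norm_sq hf (H := H * (E.ofPoly Q + 2 * E.y))
      (mul_ne_zero (mul_ne_zero ha' hb) (algebraMap_ratFunc_ne_zero hh)) ?_ fun w => ?_
    · have hac := congrArg (algebraMap F (RatFunc F)) ha
      rw [map_mul, map_mul] at hac
      rw [map_mul, mul_mul_mul_comm, hN, ofPoly_add_two_mul_y_norm hQ, ← map_mul]
      congr 1
      linear_combination b ^ 2 * algebraMap F[X] (RatFunc F) h ^ 2 * hac
    · rw [w.ord_mul hH hu]
      obtain ⟨m, hm⟩ := hpar w
      obtain ⟨m', hm'⟩ := even_ord_ofPoly_add_two_mul_y hfd hQd hc0 hh hQ hcop w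
      obtain ⟨l, rfl⟩ := hg
      push_cast at hm'
      refine ⟨m + m' - (l + 1) * E.poleOrder w, ?_⟩
      linear_combination hm + hm'

end HalfFunction

end HyperellipticEquation

/-! ### The Frobenius on polynomials -/

section Frobenius

theorem FiniteField.mem_range_algebraMap_of_pow_card {k k' : Type*} [Field k] [Finite k] [Field k']
    [Algebra k k'] {z : k'} (hz : z ^ Nat.card k = z) : z ∈ Set.range (algebraMap k k') := by
  have := Fintype.ofFinite k
  rw [Nat.card_eq_fintype_card] at hz
  have hroots := FiniteField.roots_X_pow_card_sub_X k
  have hdeg := FiniteField.X_pow_card_sub_X_natDegree_eq k (Fintype.one_lt_card (α := k))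
  have hmonic : (X ^ Fintype.card k - X : k[X]).Monic :=
    monic_X_pow_sub (by rw [degree_X]; exact_mod_cast Fintype.one_lt_card (α := k))
  have hprod := prod_multiset_X_sub_C_of_monic_of_roots_card_eq hmonic (by rw [hroots, hdeg]; rfl)
  have h0 := congrArg (aeval z) hprod
  rw [map_sub, map_pow, aeval_X, hz, sub_self, hroots, map_multiset_prod, Multiset.map_map,
    Multiset.prod_eq_zero_iff, Multiset.mem_map] at h0
  obtain ⟨a, -, ha⟩ := h0
  rw [Function.comp_apply, map_sub, aeval_X, aeval_C, sub_eq_zero] at ha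
  exact ⟨a, ha.symm⟩

variable (k : Type*) {k' : Type*} [Field k] [Finite k] [Field k'] [Algebra k k']

/-- The Frobenius `z ↦ z ^ #k` of an extension field of the finite field `k`. -/
noncomputable def frobeniusOver (k' : Type*) [Field k'] [Algebra k k'] : k' →ₐ[k] k' :=
  letI := Fintype.ofFinite k
  FiniteField.frobeniusAlgHom k k'

theorem frobeniusOver_apply (z : k') : frobeniusOver k k' z = z ^ Nat.card k := by
  let _ := Fintype.ofFinite k
  rw [Nat.card_eq_fintype_card]; rfl

variable {k}

theorem Polynomial.exists_map_eq_of_map_frobenius {A : k'[X]}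
    (hA : A.map (frobeniusOver k k' : k' →+* k') = A) :
    ∃ Q : k[X], Q.map (algebraMap k k') = A := by
  rw [← mem_lifts, lifts_iff_coeff_lifts]
  intro n
  apply FiniteField.mem_range_algebraMap_of_pow_card
  rw [← frobeniusOver_apply k]
  conv_rhs => rw [← hA, coeff_map]
  rfl

theorem Polynomial.map_frobenius_map_algebraMap (Q : k[X]) :
    (Q.map (algebraMap k k')).map (frobeniusOver k k' : k' →+* k') = Q.map (algebraMap k k') := by
  rw [map_map]; congr 1
  exact (frobeniusOver k k').comp_algebraMap

/-- A factorisation `f = A B` over an extension of the finite field `k` in which the factors are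
exchanged by the Frobenius makes `A + B` rational over `k`, and `A - B` rational up to a constant
whose square is not a square in `k`. -/
theorem Polynomial.exists_of_conjugate_factorization {f : k[X]} {A B : k'[X]} {m : ℕ}
    (h2 : (2 : k) ≠ 0) (hsep : f.Separable) (hm : 0 < m) (hA : A.Monic) (hB : B.Monic)
    (hAd : A.natDegree = m) (hBd : B.natDegree = m) (hAB : A * B = f.map (algebraMap k k'))
    (hF : A.map (frobeniusOver k k' : k' →+* k') = B) :
    ∃ (Q h : k[X]) (c : k), Q.map (algebraMap k k') = A + B ∧ Q.natDegree = m ∧ h ≠ 0 ∧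
      ¬ IsSquare c ∧ Q ^ 2 - 4 * f = C c * h ^ 2 ∧ IsCoprime Q f := by
  have hinj : Function.Injective (algebraMap k k') := (algebraMap k k').injective
  have h2' : (2 : k') ≠ 0 := by
    rw [← map_ofNat (algebraMap k k') 2]; exact (_root_.map_ne_zero _).2 h2
  have hF' : B.map (frobeniusOver k k' : k' →+* k') = A := by
    have h1 := map_frobenius_map_algebraMap (k' := k') f
    rw [← hAB, Polynomial.map_mul, hF, mul_comm A] at h1
    exact mul_left_cancel₀ hB.ne_zero h1
  obtain ⟨Q, hQ⟩ := exists_map_eq_of_map_frobenius (k := k) (A := A + B) (by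
    rw [Polynomial.map_add, hF, hF', add_comm])
  have hcopAB : IsCoprime A B := by
    have h1 : (A * B).Separable := hAB ▸ hsep.map
    exact h1.isCoprime
  have hne : A - B ≠ 0 := by
    rw [sub_ne_zero]
    rintro rfl
    have := natDegree_eq_zero_of_isUnit (isCoprime_self.1 hcopAB)
    omega
  -- the monic multiple of `A - B` is rational
  have hfrob : (A - B).map (frobeniusOver k k' : k' →+* k') = -(A - B) := by
    rw [Polynomial.map_sub, hF, hF', neg_sub]
  have hlc0 : (A - B).leadingCoeff ≠ 0 := leadingCoeff_ne_zero.2 hne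
  have hlc : frobeniusOver k k' (A - B).leadingCoeff = -(A - B).leadingCoeff := by
    have h1 := leadingCoeff_map (p := A - B) (frobeniusOver k k' : k' →+* k')
    rw [hfrob, leadingCoeff_neg] at h1
    exact h1.symm
  obtain ⟨h, hh⟩ := exists_map_eq_of_map_frobenius (k := k)
    (A := C ((A - B).leadingCoeff)⁻¹ * (A - B)) (by
      rw [Polynomial.map_mul, hfrob, map_C, RingHom.coe_coe, map_inv₀, hlc, inv_neg, C_neg,
        neg_mul_neg])
  obtain ⟨c, hc⟩ := FiniteField.mem_range_algebraMap_of_pow_card (k := k)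
    (z := (A - B).leadingCoeff ^ 2) (by
      rw [← frobeniusOver_apply k, map_pow, hlc, neg_sq])
  have hAmB : A - B = C (A - B).leadingCoeff * h.map (algebraMap k k') := by
    rw [hh, ← mul_assoc, ← C_mul, mul_inv_cancel₀ hlc0, C_1, one_mul]
  refine ⟨Q, h, c, hQ, ?_, ?_, ?_, ?_, ?_⟩
  · rw [← natDegree_map_eq_of_injective hinj Q, hQ]
    have hcoeff : (A + B).coeff m = 2 := by
      rw [coeff_add]
      nth_rw 1 [← hAd]
      rw [← hBd, coeff_natDegree, coeff_natDegree, hA.leadingCoeff, hB.leadingCoeff]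
      norm_num
    refine le_antisymm ((natDegree_add_le _ _).trans (by rw [hAd, hBd, max_self])) ?_
    exact le_natDegree_of_ne_zero (by rw [hcoeff]; exact h2')
  · rintro rfl
    rw [Polynomial.map_zero, mul_zero] at hAmB
    exact hne hAmB
  · -- a square root of `c` in `k` would be fixed by the Frobenius
    rintro ⟨b, rfl⟩
    rw [map_mul, ← sq, sq_eq_sq_iff_eq_or_eq_neg] at hc
    have hfix : frobeniusOver k k' (A - B).leadingCoeff = (A - B).leadingCoeff := by
      rcases hc with hc | hc
      · rw [← hc, AlgHom.commutes]
      · rw [← neg_eq_iff_eq_neg.2 hc, map_neg, AlgHom.commutes]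
    rw [hlc] at hfix
    refine mul_ne_zero h2' hlc0 ?_
    linear_combination -hfix
  · apply map_injective _ hinj
    have h4 : (4 : k[X]).map (algebraMap k k') = 4 := Polynomial.map_ofNat _ 4
    rw [Polynomial.map_sub, Polynomial.map_pow, Polynomial.map_mul, Polynomial.map_mul,
      Polynomial.map_pow, map_C, hQ, ← hAB, hc, h4]
    calc (A + B) ^ 2 - 4 * (A * B) = (A - B) ^ 2 := by ring
      _ = _ := by nth_rw 1 [hAmB]; rw [mul_pow, C_pow]
  · rw [← isCoprime_map (algebraMap k k'), hQ, ← hAB]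
    refine IsCoprime.mul_right ?_ ?_
    · obtain ⟨a, b, hab⟩ := hcopAB
      exact ⟨b, a - b, by linear_combination hab⟩
    · obtain ⟨a, b, hab⟩ := hcopAB
      exact ⟨a, b - a, by linear_combination hab⟩

end Frobenius

/-! ### Numberings of the roots -/

section Numbering

variable {k k' : Type*} [Field k] [Field k'] [Algebra k k'] {s : ℕ} {P : Fin s → k[X]}

theorem finSigmaFinEquiv_natDegree (i : Fin s) (j : Fin (P i).natDegree) :
    (finSigmaFinEquiv (n := fun i => (P i).natDegree) ⟨i, j⟩ : ℕ) = rootOffset P i + j := by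
  rw [finSigmaFinEquiv_apply, rootOffset]
  congr 1
  refine Finset.sum_bij (fun l _ => Fin.castLE i.2.le l) (fun l _ => ?_) (fun l _ l' _ h => ?_)
    (fun l hl => ?_) fun l _ => rfl
  · rw [Finset.mem_Iio, Fin.lt_def]; exact l.2
  · simpa using h
  · rw [Finset.mem_Iio, Fin.lt_def] at hl
    exact ⟨⟨l, hl⟩, Finset.mem_univ _, rfl⟩

theorem exists_eq_rootOffset_add {m : ℕ} (hm : m < ∑ i, (P i).natDegree) :
    ∃ (i : Fin s) (j : ℕ), j < (P i).natDegree ∧ m = rootOffset P i + j := by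
  obtain ⟨⟨i, j⟩, h⟩ := (finSigmaFinEquiv (n := fun i => (P i).natDegree)).surjective ⟨m, hm⟩
  refine ⟨i, j, j.2, ?_⟩
  rw [← finSigmaFinEquiv_natDegree, h]

theorem prod_range_eq_prod_blocks {M : Type*} [CommMonoid M] (G : ℕ → M) :
    ∏ m ∈ Finset.range (∑ i, (P i).natDegree), G m =
      ∏ i, ∏ j ∈ Finset.range (P i).natDegree, G (rootOffset P i + j) := by
  rw [Finset.prod_range, ← (finSigmaFinEquiv (n := fun i => (P i).natDegree)).prod_comp,
    Fintype.prod_sigma]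
  refine Finset.prod_congr rfl fun i _ => ?_
  rw [Finset.prod_range]
  exact Finset.prod_congr rfl fun j _ => by rw [finSigmaFinEquiv_natDegree]

theorem IsFrobeniusNumbering.map_prod {t : ℕ → k'} (ht : IsFrobeniusNumbering P t) :
    (∏ i, P i).map (algebraMap k k') =
      ∏ m ∈ Finset.range (∑ i, (P i).natDegree), (X - C (t m)) := by
  rw [prod_range_eq_prod_blocks, Polynomial.map_prod]
  exact Finset.prod_congr rfl fun i _ => (ht i).1

/-- If all blocks of roots have even length, the Frobenius maps each root of even index to the
following one. -/
theorem IsFrobeniusNumbering.pow_card_of_even {t : ℕ → k'} (ht : IsFrobeniusNumbering P t)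
    (heven : ∀ i, Even (P i).natDegree) {m : ℕ} (hm : 2 * m < ∑ i, (P i).natDegree) :
    t (2 * m) ^ Nat.card k = t (2 * m + 1) := by
  obtain ⟨i, j, hj, h⟩ := exists_eq_rootOffset_add hm
  have hoff : Even (rootOffset P i) := Finset.even_sum _ fun l _ => heven l
  obtain ⟨a, ha⟩ := hoff
  obtain ⟨b, hb⟩ := heven i
  rw [h, (ht i).2 j hj, Nat.mod_eq_of_lt (by omega), add_assoc]

theorem Finset.prod_range_two_mul {M : Type*} [CommMonoid M] (G : ℕ → M) (n : ℕ) :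
    ∏ m ∈ Finset.range (2 * n), G m =
      (∏ i ∈ Finset.range n, G (2 * i)) * ∏ i ∈ Finset.range n, G (2 * i + 1) := by
  induction n with
  | zero => simp
  | succ n ih =>
    rw [mul_add, mul_one, Finset.prod_range_succ, Finset.prod_range_succ, ih,
      Finset.prod_range_succ, Finset.prod_range_succ, mul_assoc, mul_mul_mul_comm]

/-- The rational data attached to the factorisation of `∏ i, P i` into the linear factors of even
and those of odd index. -/
theorem IsFrobeniusNumbering.exists_of_even [Finite k] {t : ℕ → k'}
    (ht : IsFrobeniusNumbering P t) (heven : ∀ i, Even (P i).natDegree) (h2 : (2 : k) ≠ 0)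
    (hsep : (∏ i, P i).Separable) {g : ℕ} (hd : ∑ i, (P i).natDegree = 2 * g + 2) :
    ∃ (Q h : k[X]) (c : k), Q.map (algebraMap k k') =
        ∏ i ∈ Finset.range (g + 1), (X - C (t (2 * i))) +
          ∏ i ∈ Finset.range (g + 1), (X - C (t (2 * i + 1))) ∧
      Q.natDegree = g + 1 ∧ h ≠ 0 ∧ ¬ IsSquare c ∧ Q ^ 2 - 4 * (∏ i, P i) = C c * h ^ 2 ∧
      IsCoprime Q (∏ i, P i) := by
  refine Polynomial.exists_of_conjugate_factorization h2 hsep g.succ_pos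
    (monic_prod_of_monic _ _ fun i _ => monic_X_sub_C _)
    (monic_prod_of_monic _ _ fun i _ => monic_X_sub_C _) ?_ ?_ ?_ ?_
  · rw [natDegree_prod_of_monic _ _ fun i _ => monic_X_sub_C _]; simp
  · rw [natDegree_prod_of_monic _ _ fun i _ => monic_X_sub_C _]; simp
  · rw [ht.map_prod, hd, show 2 * g + 2 = 2 * (g + 1) by ring, Finset.prod_range_two_mul]
  · rw [Polynomial.map_prod]
    refine Finset.prod_congr rfl fun i hi => ?_
    rw [Finset.mem_range] at hi
    rw [Polynomial.map_sub, map_X, map_C, RingHom.coe_coe, frobeniusOver_apply,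
      ht.pow_card_of_even heven (by omega)]

end Numbering

/-! ### The four cases -/

theorem Place.ord_prod {F K ι : Type*} [Field F] [Field K] [Algebra F K] (v : Place F K)
    (I : Finset ι) (h : ι → K) (hh : ∀ i ∈ I, h i ≠ 0) :
    v.ord (∏ i ∈ I, h i) = ∑ i ∈ I, v.ord (h i) := by
  classical
  induction I using Finset.induction_on with
  | empty => simp
  | insert i I hi ih =>
    rw [Finset.prod_insert hi, Finset.sum_insert hi, v.ord_mul (hh i (by simp))
      (Finset.prod_ne_zero_iff.2 fun j hj => hh j (Finset.mem_insert_of_mem hj)),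
      ih fun j hj => hh j (Finset.mem_insert_of_mem hj)]

theorem CurveDivisor.exists_two_mul_eq {F K : Type*} [Field F] [Field K] [Algebra F K]
    (o : Place F K → ℤ) (hfin : (Function.support o).Finite) (heven : ∀ v, Even (o v)) :
    ∃ D : CurveDivisor F K, ∀ v, 2 * D v = o v := by
  choose m hm using heven
  refine ⟨Finsupp.ofSupportFinite m (hfin.subset fun v hv => ?_), fun v => ?_⟩
  · rw [Function.mem_support] at hv ⊢
    rw [hm]; omega
  · rw [Finsupp.ofSupportFinite_coe, hm]; ring

namespace HyperellipticEquation

section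

variable {F : Type*} [Field F] (E : HyperellipticEquation F) {lam : Place F (RatFunc F)}
  {Q P₁ : F[X]} {L : CurveDivisor F E.FunctionField}

theorem ord_ofPoly_prod {ι : Type*} (I : Finset ι) (t : ι → F) (w : Place F E.FunctionField) :
    w.ord (E.ofPoly (∏ i ∈ I, (X - C (t i)))) = ∑ i ∈ I, w.ord (E.ofPoly (X - C (t i))) := by
  have h : E.ofPoly (∏ i ∈ I, (X - C (t i))) = ∏ i ∈ I, E.ofPoly (X - C (t i)) := by
    simp only [ofPoly, map_prod]
  rw [h]
  exact w.ord_prod _ _ fun i _ => E.ofPoly_ne_zero (X_sub_C_ne_zero (t i))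

/-- If `f` has odd degree, the double covering is ramified at `∞`, so that the pole divisor of a
polynomial of degree `n` is `2 n` times a single point. -/
theorem exists_pole_of_odd_natDegree (hodd : Odd E.f.natDegree)
    (hlam : IsAffinePointWithMinpoly lam Q)
    (hL : ⇑L = pullbackDivisor E.cover (Finsupp.single lam 1)) :
    ∃ pInf : Place F E.FunctionField, (∀ w, E.IsAtInfinity w ↔ w = pInf) ∧
      ⇑L = divFun F (E.ofPoly Q) + ⇑(Finsupp.single pInf (2 * (Q.natDegree : ℤ))) := by
  obtain ⟨pInf, e, hp⟩ := E.exists_place_over (inftyPlace F)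
  have hodd' : Odd ((inftyPlace F).ord (algebraMap F[X] (RatFunc F) E.f)) := by
    rw [ord_inftyPlace_polynomial, odd_neg]; exact_mod_cast hodd
  refine ⟨pInf, fun w => ⟨fun hw => ?_, ?_⟩, funext fun w => ?_⟩
  · obtain ⟨v, e', h⟩ := E.exists_place_under w
    have hv := (isAtInfinity_iff h).1 hw
    subst hv
    exact h.eq_of_odd hp hodd'
  · rintro rfl
    exact (isAtInfinity_iff hp).2 rfl
  · rw [hL, pullbackDivisor_cover_minpoly hlam, Pi.add_apply, divFun,
      ← pullbackDivisor_cover_of_odd hp hodd', pullbackDivisor_cover_infty]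

/-- The pull-backs of two points of the affine line of degrees `n` and `d₁` are proportional in the
Picard group, with factors `d₁` and `n`; if the second is a branch point, its pull-back is twice a
point. -/
theorem smul_eq_div_add_branch {w₀ : Place F E.FunctionField} {v₁ : Place F (RatFunc F)} {e : ℕ}
    (h₀ : Place.LiesOver E.cover w₀ v₁ e) (hP : IsAffinePointWithMinpoly v₁ P₁) (hd : P₁ ∣ E.f)
    (hlam : IsAffinePointWithMinpoly lam Q)
    (hL : ⇑L = pullbackDivisor E.cover (Finsupp.single lam 1)) :
    ⇑(P₁.natDegree • L) = divFun F (E.ofPoly Q ^ P₁.natDegree / E.ofPoly P₁ ^ Q.natDegree) +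
      ⇑((2 * Q.natDegree) • Finsupp.single w₀ (1 : ℤ)) := by
  funext w
  have hS := two_mul_single_branch (w := w) h₀ hP hd
  rw [Pi.add_apply, Finsupp.smul_apply, Finsupp.smul_apply, hL, pullbackDivisor_cover_minpoly hlam,
    divFun, w.ord_div (pow_ne_zero _ (E.ofPoly_ne_zero hlam.2.1.ne_zero))
      (pow_ne_zero _ (E.ofPoly_ne_zero hP.2.1.ne_zero)), Place.ord_pow, Place.ord_pow,
    nsmul_eq_mul, nsmul_eq_mul]
  push_cast
  linear_combination (-(Q.natDegree : ℤ)) * hS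

/-- If all irreducible factors of `f` have even degree and `g` is odd, the pull-back of a point of
odd degree is not divisible by `2` in the Picard group: up to a principal divisor, it is congruent
modulo `2` to the pull-back of `∞`. -/
theorem two_nsmul_ne_mk [Finite F] {R h : F[X]} {c : F} {g : ℕ} (hg : Odd g)
    (hf : ∀ p, p.Monic → Irreducible p → p ∣ E.f → Even p.natDegree)
    (hfd : E.f.natDegree = 2 * g + 2) (hRd : R.natDegree = g + 1) (hc : ¬ IsSquare c)
    (hh : h ≠ 0) (hR : R ^ 2 - 4 * E.f = C c * h ^ 2) (hcop : IsCoprime R E.f)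
    (hlam : IsAffinePointWithMinpoly lam Q) (hodd : Odd Q.natDegree)
    (hL : ⇑L = pullbackDivisor E.cover (Finsupp.single lam 1)) (M : CurvePic F E.FunctionField) :
    2 • M ≠ (QuotientAddGroup.mk L : CurvePic F E.FunctionField) := by
  induction M using QuotientAddGroup.induction_on with
  | H M =>
    intro heq
    have h1 : -(2 • M) + L ∈ principalDivisors F E.FunctionField := QuotientAddGroup.eq.1 heq
    obtain ⟨H, hH, hdiv⟩ := h1
    have hQ := E.ofPoly_ne_zero hlam.2.1.ne_zero
    refine not_forall_even_ord_sub_poleOrder hg hf hfd hRd hc hh hR hcop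
      (div_ne_zero hH hQ) fun w => ?_
    have hw := congrFun hdiv w
    rw [Finsupp.add_apply, Finsupp.neg_apply, Finsupp.smul_apply, hL,
      pullbackDivisor_cover_minpoly hlam, divFun, nsmul_eq_mul] at hw
    obtain ⟨l, hl⟩ := hodd
    rw [hl] at hw
    rw [w.ord_div hH hQ]
    refine ⟨l * E.poleOrder w - M w, ?_⟩
    push_cast at hw
    linear_combination -hw

end

section BaseChange

variable {F F' : Type*} [Field F] [Field F'] [Algebra F F'] [IsAlgClosed F']
  [Algebra.IsSeparable F F'] (E : HyperellipticEquation F)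

/-- A branch point of the curve over `F` becomes the sum of the branch points `T j` over the roots
of its minimal polynomial. -/
theorem pullbackDivisor_branch {w₀ : Place F E.FunctionField} {v₁ : Place F (RatFunc F)} {e : ℕ}
    {P₁ : F[X]} (h₀ : Place.LiesOver E.cover w₀ v₁ e) (hP : IsAffinePointWithMinpoly v₁ P₁)
    (hd : P₁ ∣ E.f) {t : ℕ → F'} {T : ℕ → Place F' (E.baseChange F').FunctionField}
    (hprod : P₁.map (algebraMap F F') = ∏ j ∈ Finset.range P₁.natDegree, (X - C (t j)))
    (hT : ∀ j < P₁.natDegree, ∀ w, 2 * Finsupp.single (T j) (1 : ℤ) w =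
      w.ord ((E.baseChange F').ofPoly (X - C (t j))) + (E.baseChange F').poleOrder w) :
    pullbackDivisor (E.toBaseChange F') (Finsupp.single w₀ (1 : ℤ)) =
      ⇑(∑ j ∈ Finset.range P₁.natDegree, Finsupp.single (T j) (1 : ℤ)) := by
  funext w
  obtain ⟨v, h⟩ := E.exists_liesOver_toBaseChange (F' := F') w
  have h1 := two_mul_single_branch (w := v) h₀ hP hd
  have h2 := h.ord (E.ofPoly P₁)
  rw [toBaseChange_ofPoly, Nat.cast_one, one_mul, hprod, ord_ofPoly_prod] at h2
  have h3 : 2 * (∑ j ∈ Finset.range P₁.natDegree, Finsupp.single (T j) (1 : ℤ)) w =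
      ∑ j ∈ Finset.range P₁.natDegree, w.ord ((E.baseChange F').ofPoly (X - C (t j))) +
        P₁.natDegree * (E.baseChange F').poleOrder w := by
    rw [Finsupp.finsetSum_apply, Finset.mul_sum,
      Finset.sum_congr rfl fun j hj => hT j (Finset.mem_range.1 hj) w, Finset.sum_add_distrib,
      Finset.sum_const, Finset.card_range, nsmul_eq_mul]
  rw [h.pullbackDivisor_apply, Nat.cast_one, one_mul]
  refine mul_left_cancel₀ (_root_.two_ne_zero (α := ℤ)) ?_
  rw [h1, h3, ← h2, poleOrder_toBaseChange h]

/-- The divisor `D` for even `g` is obtained as half of the divisor of `Q + 2 y` plus `n` times the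
pull-back of `∞`. Over the extension, where `(A + y) ^ 2 = A (A + B + 2 y)`, it is given by the
stated formula, as divisors can be divided by `2` in at most one way. -/
theorem exists_half_divisor {Q h Qlam : F[X]} {c : F} {g n : ℕ} {A B : F'[X]}
    {lam : Place F (RatFunc F)} {L : CurveDivisor F E.FunctionField} (hg : Even g) (hn : Odd n)
    (hfd : E.f.natDegree = 2 * g + 2) (hQd : Q.natDegree = g + 1) (hc : c ≠ 0)
    (hh : h ≠ 0) (hQ : Q ^ 2 - 4 * E.f = C c * h ^ 2) (hcop : IsCoprime Q E.f)
    (hQAB : Q.map (algebraMap F F') = A + B) (hAB : A * B = E.f.map (algebraMap F F'))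
    (hlam : IsAffinePointWithMinpoly lam Qlam) (hlamd : Qlam.natDegree = n)
    (hL : ⇑L = pullbackDivisor E.cover (Finsupp.single lam 1))
    {t : ℕ → F'} {T : ℕ → Place F' (E.baseChange F').FunctionField}
    (hA : A = ∏ i ∈ Finset.range (g + 1), (X - C (t i)))
    (hT : ∀ i < g + 1, ∀ w, 2 * Finsupp.single (T i) (1 : ℤ) w =
      w.ord ((E.baseChange F').ofPoly (X - C (t i))) + (E.baseChange F').poleOrder w)
    (hAy : (E.baseChange F').ofPoly A + (E.baseChange F').y ≠ 0) :
    ∃ D : CurveDivisor F E.FunctionField,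
      pullbackDivisor (E.toBaseChange F') D =
        ⇑(∑ i ∈ Finset.range (g + 1), Finsupp.single (T i) (1 : ℤ)) +
          pullbackDivisor (E.baseChange F').cover
            (Finsupp.single (inftyPlace F') (((n : ℤ) - g - 1) / 2)) -
          divFun F' ((E.baseChange F').ofPoly A /
            ((E.baseChange F').ofPoly A + (E.baseChange F').y)) ∧
      ⇑L = divFun F (E.ofPoly Qlam / (E.ofPoly Q + 2 * E.y)) + ⇑(2 • D) := by
  have hu := E.ofPoly_add_two_mul_y_ne_zero Q
  obtain ⟨D, hD⟩ := CurveDivisor.exists_two_mul_eq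
    (fun w => w.ord (E.ofPoly Q + 2 * E.y) + n * E.poleOrder w)
    (((finite_setOf_ord_ne_zero hu).union (finite_support_poleOrder (E := E))).subset fun w hw => by
      by_contra hcon
      have h1 : w.ord (E.ofPoly Q + 2 * E.y) = 0 := not_not.1 fun h' => hcon (Or.inl h')
      have h2 : E.poleOrder w = 0 := not_not.1 fun h' => hcon (Or.inr h')
      exact hw (by simp only [h1, h2, mul_zero, add_zero]))
    (fun w => by
      obtain ⟨m, hm⟩ := even_ord_ofPoly_add_two_mul_y hfd hQd hc hh hQ hcop w
      obtain ⟨l, rfl⟩ := hn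
      obtain ⟨l', rfl⟩ := hg
      refine ⟨m + (l - l') * E.poleOrder w, ?_⟩
      push_cast at hm ⊢
      linear_combination hm)
  refine ⟨D, funext fun w => ?_, funext fun w => ?_⟩
  · obtain ⟨v, hv⟩ := E.exists_liesOver_toBaseChange (F' := F') w
    have hA0 : A ≠ 0 := by rw [hA]; exact Finset.prod_ne_zero_iff.2 fun i _ => X_sub_C_ne_zero _
    have hA0' := (E.baseChange F').ofPoly_ne_zero hA0
    have hordA : w.ord ((E.baseChange F').ofPoly A) =
        ∑ i ∈ Finset.range (g + 1), w.ord ((E.baseChange F').ofPoly (X - C (t i))) := by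
      rw [hA, ord_ofPoly_prod]
    have h3 : 2 * (∑ i ∈ Finset.range (g + 1), Finsupp.single (T i) (1 : ℤ)) w =
        w.ord ((E.baseChange F').ofPoly A) + (g + 1) * (E.baseChange F').poleOrder w := by
      rw [hordA, Finsupp.finsetSum_apply, Finset.mul_sum,
        Finset.sum_congr rfl fun i hi => hT i (Finset.mem_range.1 hi) w, Finset.sum_add_distrib,
        Finset.sum_const, Finset.card_range, nsmul_eq_mul]
      push_cast; ring
    have hsq : ((E.baseChange F').ofPoly A + (E.baseChange F').y) ^ 2 =
        (E.baseChange F').ofPoly A * E.toBaseChange F' (E.ofPoly Q + 2 * E.y) := by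
      have hf := (E.baseChange F').y_sq
      rw [show (E.baseChange F').f = A * B from hAB.symm, ofPoly_mul] at hf
      rw [map_add, map_mul, toBaseChange_ofPoly, toBaseChange_y, hQAB, ofPoly_add, map_ofNat]
      linear_combination hf
    have h4 := congrArg w.ord hsq
    rw [Place.ord_pow, w.ord_mul hA0' ((_root_.map_ne_zero _).2 hu), hv.ord] at h4
    have hn2 : 2 * (((n : ℤ) - g - 1) / 2) = n - g - 1 := by
      obtain ⟨l, rfl⟩ := hn
      obtain ⟨l', rfl⟩ := hg
      omega
    rw [Pi.sub_apply, Pi.add_apply, hv.pullbackDivisor_apply, Nat.cast_one, one_mul,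
      pullbackDivisor_cover_infty, divFun, w.ord_div hA0' hAy]
    refine mul_left_cancel₀ (_root_.two_ne_zero (α := ℤ)) ?_
    push_cast at h4
    rw [hD, ← poleOrder_toBaseChange hv]
    linear_combination (-1 : ℤ) * h3 - h4 - (E.baseChange F').poleOrder w * hn2
  · rw [hL, pullbackDivisor_cover_minpoly hlam, hlamd, Pi.add_apply, divFun,
      w.ord_div (E.ofPoly_ne_zero hlam.2.1.ne_zero) hu, Finsupp.smul_apply, nsmul_eq_mul]
    have := hD w
    push_cast
    linear_combination -this

end BaseChange

end HyperellipticEquation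

theorem mainTheorem10 {k : Type*} [Field k] [Finite k] (hk : ringChar k ≠ 2)
    {s : ℕ} (hs : 0 < s) (P : Fin s → k[X]) (hmonic : ∀ i, (P i).Monic)
    (hirr : ∀ i, Irreducible (P i)) (hinj : Function.Injective P)
    (d g : ℕ) (hd : d = ∑ i, (P i).natDegree) (hg : d = 2 * g + 1 ∨ d = 2 * g + 2)
    (t : ℕ → AlgebraicClosure k) (ht : IsFrobeniusNumbering P t)
    (lam : Place k (RatFunc k)) (Plam : k[X]) (hlam : IsAffinePointWithMinpoly lam Plam)
    (n : ℕ) (hn : Plam.natDegree = n) (hodd : Odd n) :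
    let E := hyperellipticOfFactors hk hs P hmonic hirr hinj
    let Ebar := E.baseChange (AlgebraicClosure k)
    let d₁ := (P ⟨0, hs⟩).natDegree
    -- the geometric points `(t_j, 0)` exist and are unique, and `L` is the divisor `r^* lam`
    ∃ (T : ℕ → Place (AlgebraicClosure k) Ebar.FunctionField)
      (L : CurveDivisor k E.FunctionField),
      (∀ j < d, ∀ w, Ebar.IsPoint w (t j) 0 ↔ w = T j) ∧
      ⇑L = pullbackDivisor E.cover (Finsupp.single lam 1) ∧
      -- (1)
      (Odd d →
        ∃ pInf : Place k E.FunctionField, (∀ w, E.IsAtInfinity w ↔ w = pInf) ∧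
          ⇑L = divFun k (E.ofPoly Plam) + ⇑(Finsupp.single pInf (2 * (n : ℤ)))) ∧
      -- (2)
      (Even d → Odd d₁ →
        ∃ S : CurveDivisor k E.FunctionField,
          pullbackDivisor (E.toBaseChange (AlgebraicClosure k)) S =
            ⇑(∑ j ∈ Finset.range d₁, Finsupp.single (T j) (1 : ℤ)) ∧
          ⇑(d₁ • L) =
            divFun k (E.ofPoly Plam ^ d₁ / E.ofPoly (P ⟨0, hs⟩) ^ n) + ⇑((2 * n) • S)) ∧
      -- (3)
      ((∀ i, Even (P i).natDegree) → Even g →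
        let A : (AlgebraicClosure k)[X] := ∏ i ∈ Finset.range (g + 1), (X - C (t (2 * i)))
        let B : (AlgebraicClosure k)[X] := ∏ i ∈ Finset.range (g + 1), (X - C (t (2 * i + 1)))
        ∃ (Q : k[X]) (D : CurveDivisor k E.FunctionField),
          Q.map (algebraMap k (AlgebraicClosure k)) = A + B ∧
          E.ofPoly Q + 2 * E.y ≠ 0 ∧
          Ebar.ofPoly A + Ebar.y ≠ 0 ∧
          -- the integer `n - g - 1` is even, so the division is exact
          pullbackDivisor (E.toBaseChange (AlgebraicClosure k)) D =
            ⇑(∑ i ∈ Finset.range (g + 1), Finsupp.single (T (2 * i)) (1 : ℤ)) +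
              pullbackDivisor Ebar.cover
                (Finsupp.single (inftyPlace (AlgebraicClosure k)) (((n : ℤ) - g - 1) / 2)) -
              divFun (AlgebraicClosure k) (Ebar.ofPoly A / (Ebar.ofPoly A + Ebar.y)) ∧
          ⇑L = divFun k (E.ofPoly Plam / (E.ofPoly Q + 2 * E.y)) + ⇑(2 • D)) ∧
      -- (4)
      ((∀ i, Even (P i).natDegree) → Odd g →
        ∀ M : CurvePic k E.FunctionField,
          2 • M ≠ (QuotientAddGroup.mk L : CurvePic k E.FunctionField)) := by
  intro E Ebar d₁
  have hEf : E.f = ∏ i, P i := rfl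
  have hEd : E.f.natDegree = d := by
    rw [hEf, natDegree_prod _ _ fun i _ => (hirr i).ne_zero, hd]
  have hfmap : Ebar.f = ∏ m ∈ Finset.range d, (X - C (t m)) := by
    rw [hd, ← ht.map_prod]; rfl
  have hroot : ∀ j < d, X - C (t j) ∣ Ebar.f := fun j hj => by
    rw [hfmap]; exact Finset.dvd_prod_of_mem _ (Finset.mem_range.2 hj)
  obtain ⟨L, hL⟩ := E.exists_divisor_eq_pullback (Finsupp.single lam 1)
  have hTex : ∀ j, ∃ T : Place (AlgebraicClosure k) Ebar.FunctionField, j < d →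
      (∀ w, Ebar.IsPoint w (t j) 0 ↔ w = T) ∧
      ∀ w, 2 * Finsupp.single T (1 : ℤ) w =
        w.ord (Ebar.ofPoly (X - C (t j))) + Ebar.poleOrder w := by
    intro j
    by_cases hj : j < d
    · obtain ⟨T, v, e, hv, hT, hiff⟩ := HyperellipticEquation.exists_isPoint_iff (E := Ebar)
        (dvd_iff_isRoot.1 (hroot j hj))
      refine ⟨T, fun _ => ⟨hiff, fun w => ?_⟩⟩
      rw [HyperellipticEquation.two_mul_single_branch hT hv (hroot j hj), natDegree_X_sub_C,
        Nat.cast_one, one_mul]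
    · -- there is no condition on `T j`, so any place will do
      obtain ⟨T, -, -⟩ := Ebar.exists_place_over (inftyPlace _)
      exact ⟨T, fun h => absurd h hj⟩
  choose T hT using hTex
  refine ⟨T, L, fun j hj => (hT j hj).1, hL, ?_, ?_, ?_, ?_⟩
  · intro hdodd
    subst hn
    exact E.exists_pole_of_odd_natDegree (hEd ▸ hdodd) hlam hL
  · intro _ _
    have hP0 : P ⟨0, hs⟩ ∣ E.f := Finset.dvd_prod_of_mem P (Finset.mem_univ _)
    obtain ⟨v₁, hv₁⟩ := exists_place_of_irreducible (hirr ⟨0, hs⟩) (hmonic ⟨0, hs⟩)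
    obtain ⟨w₀, e, hw₀⟩ := E.exists_place_over v₁
    have hoff : rootOffset P ⟨0, hs⟩ = 0 := by
      rw [rootOffset, Finset.sum_eq_zero]
      intro l hl
      rw [Finset.mem_Iio, Fin.lt_def] at hl
      exact absurd hl (Nat.not_lt_zero _)
    have hd₁ : d₁ ≤ d := by
      rw [hd]
      exact Finset.single_le_sum (f := fun i => (P i).natDegree) (fun _ _ => Nat.zero_le _)
        (Finset.mem_univ _)
    have hprod := (ht ⟨0, hs⟩).1
    simp only [hoff, zero_add] at hprod
    refine ⟨Finsupp.single w₀ 1, ?_, ?_⟩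
    · exact E.pullbackDivisor_branch hw₀ hv₁ hP0 hprod fun j hj => (hT j (hj.trans_le hd₁)).2
    · subst hn
      exact E.smul_eq_div_add_branch hw₀ hv₁ hP0 hlam hL
  · intro heven hgeven A B
    have hd2 : d = 2 * g + 2 := by
      have : Even d := hd ▸ Finset.even_sum _ fun i _ => heven i
      obtain ⟨m, hm⟩ := this
      omega
    obtain ⟨Q, h, c, hQAB, hQd, hh, hc, hQ, hcop⟩ :=
      ht.exists_of_even heven E.two_ne_zero E.separable (hd ▸ hd2)
    have hAB : A * B = E.f.map (algebraMap k (AlgebraicClosure k)) := by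
      change _ = Ebar.f
      rw [hfmap, hd2, show 2 * g + 2 = 2 * (g + 1) by ring, Finset.prod_range_two_mul]
    have hAy : Ebar.ofPoly A + Ebar.y ≠ 0 := Ebar.ofPoly_add_y_ne_zero A
    have hc0 : c ≠ 0 := by rintro rfl; exact hc ⟨0, by ring⟩
    obtain ⟨D, hD, hLD⟩ := E.exists_half_divisor (T := fun i => T (2 * i)) hgeven hodd
      (hEd.trans hd2) hQd hc0 hh hQ hcop hQAB hAB hlam hn hL rfl
      (fun i hi => (hT (2 * i) (by omega)).2) hAy
    exact ⟨Q, D, hQAB, E.ofPoly_add_two_mul_y_ne_zero Q, hAy, hD, hLD⟩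
  · intro heven hgodd M
    have hd2 : d = 2 * g + 2 := by
      have : Even d := hd ▸ Finset.even_sum _ fun i _ => heven i
      obtain ⟨m, hm⟩ := this
      omega
    obtain ⟨Q, h, c, -, hQd, hh, hc, hQ, hcop⟩ :=
      ht.exists_of_even heven E.two_ne_zero E.separable (hd ▸ hd2)
    refine E.two_nsmul_ne_mk hgodd (fun p hpm hp hpf => ?_) (hEd.trans hd2) hQd hc hh hQ hcop hlam
      (hn ▸ hodd) hL M
    rw [hEf] at hpf
    obtain ⟨i, -, hi⟩ := hp.prime.exists_mem_finset_dvd hpf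
    rw [eq_of_monic_of_associated hpm (hmonic i) (hp.associated_of_dvd (hirr i) hi)]
    exact heven i
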